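/- Let $\mathcal M=(\mathcal S,\mathcal A,\mathbb P,R,\gamma)$ be a discounted Markov decision process (MDP) with finite nonempty state space $\mathcal S$ ($S=|\mathcal S|$), finite action space $\mathcal A$, transition kernel $\mathbb P(s'|s,a)$, deterministic rewards $0\le R(s,a)\le 1$ and discount factor $\gamma\in[0,1)$. For a policy $\pi:\mathcal S\to\Delta(\mathcal A)$ (where $\Delta(\cdot)$ denotes the probability distributions on a finite set) put $Q^\pi_{\mathcal M}(s,a)=\mathbb E\big[\sum_{t\ge 0}\gamma^tR(s_t,a_t)\mid s_0=s,a_0=a\big]$, where $s_{t+1}\sim\mathbb P(\cdot|s_t,a_t)$ and $a_{t+1}\sim\pi(\cdot|s_{t+1})$; put $V^\pi_{\mathcal M}(s)=\mathbb E_{a\sim\pi(\cdot|s)}[Q^\pi_{\mathcal M}(s,a)]$ and $V^*_{\mathcal M}(s)=\sup_\pi V^\pi_{\mathcal M}(s)$; the same notation is used for other MDPs. Let $g:\mathcal A\to\mathcal G$ be a surjective grouping function onto a finite nonempty set $\mathcal G$ of groups, $|g|=|\mathcal G|$, $\mathcal A_h=g^{-1}(h)$, and let $\pi^{\mathsf i}(\cdot|h)\in\Delta(\mathcal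 A_h)$, $h\in\mathcal G$, be a lower-level policy. The grouped MDP is $\mathcal M_G=(\mathcal S,\mathcal G,\mathbb P_G,R_G,\gamma)$ with $\mathbb P_G(s'|s,h)=\mathbb E_{a\sim\pi^{\mathsf i}(\cdot|h)}[\mathbb P(s'|s,a)]$ and $R_G(s,h)=\mathbb E_{a\sim\pi^{\mathsf i}(\cdot|h)}[R(s,a)]$. For every pair $(s,h)$ one draws $K'\ge 1$ next states from $\mathbb P_G(\cdot|s,h)$, all draws being independent, so that $K=S|g|K'$ samples are drawn in total. Let $\hat{\mathcal M}_G=(\mathcal S,\mathcal G,\hat{\mathbb P}_G,R_G,\gamma)$ be the estimated grouped MDP, with $\hat{\mathbb P}_G(s'|s,h)$ the fraction of the $K'$ draws at $(s,h)$ that equal $s'$. Let $\pi^{\mathsf o}_T:\mathcal S\to\Delta(\mathcal G)$ be the (sample-dependent) output of a planner such that, almost surely, $$\big\|V^*_{\hat{\mathcal M}_G}-V^{\pi^{\mathsf o}_T}_{\hat{\mathcal M}_G}\big\|_\infty\le\epsilon_{opt},$$ and let $\pi_{G,T}(a|s)=\pi^{\mathsf o}_T(g(a)|s)\,\pi^{\mathsf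 i}(a|g(a))$ be the resulting grouped policy on $\mathcal M$. Let $0<\delta<1$ and suppose that $$K\ge\frac{648\,S|g|\log\frac{8S|g|}{\delta(1-\gamma)}}{(1-\gamma)^2}.$$ Then, with probability greater than $1-\delta$, $$\|V^*_{\mathcal M}-V^{\pi_{G,T}}_{\mathcal M}\|_\infty\le 2\left(\frac{\gamma\beta_P^*}{(1-\gamma)^2}+\frac{\beta_R^*}{1-\gamma}\right)+20\gamma\sqrt{\frac{S|g|\log\frac{8S|g|}{\delta(1-\gamma)}}{K(1-\gamma)^3}}+\frac{4\epsilon_{opt}}{1-\gamma},$$ where $$\beta_P^*=1-\min_{s\in\mathcal S,\,h\in\mathcal G}\sum_{s'\in\mathcal S}\min_{a\in\mathcal A_h}\mathbb P(s'|s,a),\qquad \beta_R^*=\max_{s\in\mathcal S,\;g(a_1)=g(a_2)}\big(R(s,a_1)-R(s,a_2)\big).$$ Moreover, $\beta_P^*$ and $\beta_R^*$ are the minimal deviation factors: $\beta_P^*$ is the least value of $\max_{s,a}b(s,a)$ over all decompositions $\mathbb P(s'|s,a)=(1-b(s,a))\mathbb P_1(s'|s,g(a))+b(s,a)\mathbb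 P_2(s'|s,a)$ with $b$ valued in $[0,1]$ and $\mathbb P_1,\mathbb P_2$ transition probability distributions, and $\beta_R^*$ is the least value of $\max_{s,a}b(s,a)$ over all decompositions $R(s,a)=(1-b(s,a))R_1(s,g(a))+b(s,a)R_2(s,a)$ with $b,R_1,R_2$ valued in $[0,1]$. -/

import Mathlib

open MeasureTheory ProbabilityTheory
open scoped ENNReal

/-- An infinite-horizon discounted Markov decision process with state space `S` and action space
`A`: transition kernel, deterministic reward function and discount factor. -/
structure MDP (S A : Type*) where
  /-- transition kernel: `P s a s'` is the probability of moving from `s` to `s'` under `a` -/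
  P : S → A → PMF S
  /-- reward function -/
  R : S → A → ℝ
  /-- discount factor -/
  γ : ℝ

namespace MDP

section Value

variable {S A : Type*} [Fintype S] [Fintype A]
  [MeasurableSpace S] [DiscreteMeasurableSpace S]
  [MeasurableSpace A] [DiscreteMeasurableSpace A]

/-- Law of the next state-action pair: `s' ∼ P(·|s, a)`, then `a' ∼ π(·|s')`. -/
noncomputable def step (M : MDP S A) (π : S → PMF A) (z : S × A) : PMF (S × A) :=
  (M.P z.1 z.2).bind fun s' => (π s').map fun a' => (s', a')

/-- The one-step kernels of the trajectory `(s₀, a₀), (s₁, a₁), …` under the policy `π`: given the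
history up to time `n`, the next state-action pair depends on the last one only. -/
noncomputable def stepKernel (M : MDP S A) (π : S → PMF A) (n : ℕ) :
    Kernel ((i : Finset.Iic n) → S × A) (S × A) where
  toFun hist := (M.step π (hist ⟨n, Finset.mem_Iic.2 le_rfl⟩)).toMeasure
  measurable' := Measurable.of_discrete

instance (M : MDP S A) (π : S → PMF A) (n : ℕ) : IsMarkovKernel (M.stepKernel π n) where
  isProbabilityMeasure hist :=
    inferInstanceAs (IsProbabilityMeasure
      (M.step π (hist ⟨n, Finset.mem_Iic.2 le_rfl⟩)).toMeasure)

/-- Law of the trajectory `((s_t, a_t))_{t ≥ 0}` that starts from the state-action pair `z` and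
follows the policy `π`. -/
noncomputable def trajectory (M : MDP S A) (π : S → PMF A) (z : S × A) :
    Measure (ℕ → S × A) :=
  Kernel.traj (X := fun _ : ℕ => S × A) (fun n => M.stepKernel π n) 0 (fun _ => z)

/-- State-action value function `Q^π(s, a) = 𝔼[∑ₜ γ^t R(s_t, a_t) | s₀ = s, a₀ = a]`. -/
noncomputable def Q (M : MDP S A) (π : S → PMF A) (s : S) (a : A) : ℝ :=
  ∫ τ, ∑' t : ℕ, M.γ ^ t * M.R (τ t).1 (τ t).2 ∂(M.trajectory π (s, a))

/-- State value function `V^π(s) = 𝔼_{a ∼ π(·|s)}[Q^π(s, a)]`. -/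
noncomputable def V (M : MDP S A) (π : S → PMF A) (s : S) : ℝ :=
  ∑ a, (π s a).toReal * M.Q π s a

/-- Optimal state value function: `V^*(s)` is the supremum of `V^π(s)` over all policies. -/
noncomputable def optV (M : MDP S A) (s : S) : ℝ :=
  ⨆ π : S → PMF A, M.V π s

end Value

section Grouping

variable {S A G : Type*} [Fintype S] [Fintype A]

/-- The grouped MDP, whose actions are the groups: choosing the group `h` means drawing the action
from the lower-level policy `πi h`. -/
noncomputable def grouped (M : MDP S A) (πi : G → PMF A) : MDP S G where
  P s h := (πi h).bind (M.P s)
  R s h := ∑ a, (πi h a).toReal * M.R s a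
  γ := M.γ

/-- Probability deviation factors `max_{s,a} b(s, a)` of all linear decompositions
`P(s'|s,a) = (1 - b(s,a)) P₁(s'|s,g(a)) + b(s,a) P₂(s'|s,a)`. -/
def probDeviationFactors (M : MDP S A) (g : A → G) : Set ℝ :=
  {β | ∃ (b : S → A → ℝ) (P₁ : S → G → PMF S) (P₂ : S → A → PMF S),
    (∀ s a, b s a ∈ Set.Icc (0 : ℝ) 1) ∧
    (∀ s a s', (M.P s a s').toReal =
      (1 - b s a) * (P₁ s (g a) s').toReal + b s a * (P₂ s a s').toReal) ∧
    β = ⨆ z : S × A, b z.1 z.2}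

/-- Reward deviation factors `max_{s,a} b(s, a)` of all linear decompositions
`R(s,a) = (1 - b(s,a)) R₁(s,g(a)) + b(s,a) R₂(s,a)` with `R₁` and `R₂` valued in `[0, 1]`. -/
def rewardDeviationFactors (M : MDP S A) (g : A → G) : Set ℝ :=
  {β | ∃ (b : S → A → ℝ) (R₁ : S → G → ℝ) (R₂ : S → A → ℝ),
    (∀ s a, b s a ∈ Set.Icc (0 : ℝ) 1) ∧
    (∀ s h, R₁ s h ∈ Set.Icc (0 : ℝ) 1) ∧ (∀ s a, R₂ s a ∈ Set.Icc (0 : ℝ) 1) ∧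
    (∀ s a, M.R s a = (1 - b s a) * R₁ s (g a) + b s a * R₂ s a) ∧
    β = ⨆ z : S × A, b z.1 z.2}

/-- `β_P^* = 1 - min_{s,h} ∑_{s'} min_{g(a) = h} P(s'|s,a)`. -/
noncomputable def betaP (M : MDP S A) (g : A → G) : ℝ :=
  1 - ⨅ z : S × G, ∑ s', ⨅ a : {a : A // g a = z.2}, (M.P z.1 a s').toReal

/-- `β_R^* = max_{s, g(a₁) = g(a₂)} (R(s,a₁) - R(s,a₂))`. -/
noncomputable def betaR (M : MDP S A) (g : A → G) : ℝ :=
  ⨆ z : S × {p : A × A // g p.1 = g p.2}, (M.R z.1 z.2.1.1 - M.R z.1 z.2.1.2)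

end Grouping

end MDP

/-- The joint policy `π^o ∘ π^i`: draw a group from the higher-level policy, then an action from
the lower-level policy of that group. -/
noncomputable def jointPolicy {S A G : Type*} (πo : S → PMF G) (πi : G → PMF A) : S → PMF A :=
  fun s => (πo s).bind πi

section Empirical

variable {S A : Type*} [Fintype S] [DecidableEq S]

/-- Empirical distribution of the points `x 0, …, x (N - 1)`: the point `s` has mass
`#{k | x k = s} / N`. -/
noncomputable def empiricalPMF {N : ℕ} [NeZero N] (x : Fin N → S) : PMF S :=
  PMF.ofFintype (fun s => ((Finset.univ.filter fun k => x k = s).card : ℝ≥0∞) / (N : ℝ≥0∞)) <| by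
    simp only [div_eq_mul_inv]
    rw [← Finset.sum_mul, ← Nat.cast_sum,
      ← Finset.card_eq_sum_card_fiberwise (fun k _ => Finset.mem_coe.2 (Finset.mem_univ (x k))),
      Finset.card_univ, Fintype.card_fin]
    exact ENNReal.mul_inv_cancel (Nat.cast_ne_zero.2 (NeZero.ne N)) (ENNReal.natCast_ne_top N)

/-- The estimated MDP built from `N` sampled rewards `r s a k` and next states `x s a k` for each
pair `(s, a)`. -/
noncomputable def empiricalMDP {N : ℕ} [NeZero N] (γ : ℝ) (r : S → A → Fin N → ℝ)
    (x : S → A → Fin N → S) : MDP S A where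
  P s a := empiricalPMF (x s a)
  R s a := (∑ k, r s a k) / N
  γ := γ

end Empirical

/-- `X s a 0, …, X s a (N - 1)`, for all pairs `(s, a)`, are the next states returned by a
generative model of `M`: they are independent, and `X s a k ∼ P(·|s, a)`. -/
structure IsGenerativeSample {S A Ω : Type*} [MeasurableSpace S] [MeasurableSpace Ω]
    (M : MDP S A) {N : ℕ} (X : S → A → Fin N → Ω → S) (μ : Measure Ω) : Prop where
  measurable : ∀ s a k, Measurable (X s a k)
  law : ∀ s a k, μ.map (X s a k) = (M.P s a).toMeasure
  indep : iIndepFun (fun i : S × A × Fin N => X i.1 i.2.1 i.2.2) μ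

/-! A policy over groups followed by `πi` has the same value in the original MDP as in the grouped
one (`V_jointPolicy`). The loss therefore splits into a grouping error, the gap between the two
optimal values, and a planning error inside the grouped MDP.

Grouping: the actions of a group share the mass min_a P(s'|s,a), so replacing an action by the
average over its group costs at most `betaR` in reward and `betaP`/(1-γ) in expected continuation
value. Accumulated over the discounted horizon this is the bracket of the theorem, once
(`optV_sub_optV_grouped_le`); its factor 2 is slack. Normalising the common mass and the remainder
gives the minimal decomposition of the kernel.

Sampling: the rate (1-γ)^(-3/2) rests on three facts. Bernstein's inequality makes the error of the
empirical kernel at a function v about q times the standard deviation of v, with q² of order log/N.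
Along a policy, the discounted sum of the one-step variances of its value is O((1-γ)^(-2)), not the
trivial O((1-γ)^(-3)). A function f dominating this sum (`IsVarianceCertificate`) encodes it, after
standard deviations are linearised by AM-GM (`two_mul_sqrt_mul_le`). Bernstein does not apply to the
empirical optimal value, which depends on the same samples. At a state s it is replaced by the
optimal value of the empirical model with s made absorbing, which ignores the samples at s. Since
that value is 1-Lipschitz in the value put at s, finitely many grid values suffice
(`abs_optV_sub_optV_absorb_le`). `optV_sub_V_le_of_bernstein` combines these bounds
deterministically. -/

namespace PMF

/-! ### Expectations under finite distributions -/

section Expect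

variable {α β : Type*} [Fintype α] [Fintype β]

/-- Expectation of a real function under a probability mass function on a finite type. -/
noncomputable def expect (p : PMF α) (f : α → ℝ) : ℝ := ∑ a, (p a).toReal * f a

lemma sum_toReal (p : PMF α) : ∑ a, (p a).toReal = 1 := by
  rw [← ENNReal.toReal_sum (fun a _ => p.apply_ne_top a), ← tsum_fintype (L := .unconditional α),
    p.tsum_coe, ENNReal.toReal_one]

lemma expect_add (p : PMF α) (f g : α → ℝ) :
    p.expect (fun a => f a + g a) = p.expect f + p.expect g := by
  simp [expect, mul_add, Finset.sum_add_distrib]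

lemma expect_sub (p : PMF α) (f g : α → ℝ) :
    p.expect (fun a => f a - g a) = p.expect f - p.expect g := by
  simp [expect, mul_sub, Finset.sum_sub_distrib]

lemma expect_const_mul (p : PMF α) (c : ℝ) (f : α → ℝ) :
    p.expect (fun a => c * f a) = c * p.expect f := by
  simp only [expect, Finset.mul_sum]
  exact Finset.sum_congr rfl fun a _ => by ring

lemma expect_const (p : PMF α) (c : ℝ) : p.expect (fun _ => c) = c := by
  simp [expect, ← Finset.sum_mul, sum_toReal]

lemma expect_mono (p : PMF α) {f g : α → ℝ} (h : ∀ a, f a ≤ g a) : p.expect f ≤ p.expect g :=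
  Finset.sum_le_sum fun a _ => mul_le_mul_of_nonneg_left (h a) ENNReal.toReal_nonneg

lemma expect_mono_of_mem_support (p : PMF α) {f g : α → ℝ} (h : ∀ a ∈ p.support, f a ≤ g a) :
    p.expect f ≤ p.expect g := by
  refine Finset.sum_le_sum fun a _ => ?_
  by_cases ha : a ∈ p.support
  · exact mul_le_mul_of_nonneg_left (h a ha) ENNReal.toReal_nonneg
  · simp [(p.apply_eq_zero_iff a).2 ha]

lemma expect_le (p : PMF α) {f : α → ℝ} {c : ℝ} (h : ∀ a, f a ≤ c) : p.expect f ≤ c :=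
  (p.expect_mono h).trans_eq (p.expect_const c)

lemma le_expect (p : PMF α) {f : α → ℝ} {c : ℝ} (h : ∀ a, c ≤ f a) : c ≤ p.expect f :=
  (p.expect_const c).symm.le.trans (p.expect_mono h)

lemma abs_expect_le (p : PMF α) {f : α → ℝ} {c : ℝ} (h : ∀ a, |f a| ≤ c) : |p.expect f| ≤ c :=
  abs_le.2 ⟨p.le_expect fun a => (abs_le.1 (h a)).1, p.expect_le fun a => (abs_le.1 (h a)).2⟩

lemma expect_pure [DecidableEq α] (a : α) (f : α → ℝ) : (pure a).expect f = f a := by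
  rw [expect, Finset.sum_eq_single a] <;> simp +contextual

lemma expect_bind (p : PMF α) (q : α → PMF β) (f : β → ℝ) :
    (p.bind q).expect f = p.expect fun a => (q a).expect f := by
  have h : ∀ b, ((p.bind q) b).toReal = ∑ a, (p a).toReal * (q a b).toReal := fun b => by
    rw [bind_apply, tsum_fintype, ENNReal.toReal_sum]
    · simp
    · exact fun a _ => ENNReal.mul_ne_top (p.apply_ne_top a) ((q a).apply_ne_top b)
  simp only [expect, h, Finset.sum_mul, Finset.mul_sum]
  rw [Finset.sum_comm]
  exact Finset.sum_congr rfl fun a _ => Finset.sum_congr rfl fun b _ => by ring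

lemma expect_map (p : PMF α) (φ : α → β) (f : β → ℝ) :
    (p.map φ).expect f = p.expect (f ∘ φ) := by
  classical
  rw [← bind_pure_comp, expect_bind]
  exact congrArg p.expect (funext fun a => by simp [expect_pure])

lemma integral_toMeasure [MeasurableSpace α] [MeasurableSingletonClass α] (p : PMF α)
    (f : α → ℝ) : ∫ a, f a ∂p.toMeasure = p.expect f := by
  simp [integral_eq_sum, expect]

lemma exists_toReal_eq (f : α → ℝ) (h0 : ∀ a, 0 ≤ f a) (h1 : ∑ a, f a = 1) :
    ∃ p : PMF α, ∀ a, (p a).toReal = f a :=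
  ⟨ofFintype (fun a => ENNReal.ofReal (f a)) (by
    rw [← ENNReal.ofReal_sum_of_nonneg fun a _ => h0 a, h1, ENNReal.ofReal_one]),
    fun a => by simp [h0 a]⟩

end Expect

end PMF

/-! ### From trajectories to the Bellman equation -/

namespace MDP

section Bellman

variable {S A : Type*} [Fintype S] [Fintype A]

/-- One-step lookahead `R(s, a) + γ 𝔼_{s' ∼ P(·|s, a)}[v(s')]`. -/
noncomputable def lookahead (M : MDP S A) (v : S → ℝ) (s : S) (a : A) : ℝ :=
  M.R s a + M.γ * (M.P s a).expect v

lemma expect_step (M : MDP S A) (π : S → PMF A) (z : S × A) (f : S × A → ℝ) :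
    (M.step π z).expect f =
      (M.P z.1 z.2).expect fun s' => (π s').expect fun a' => f (s', a') := by
  simp only [step, PMF.expect_bind, PMF.expect_map]
  rfl

variable [MeasurableSpace S] [DiscreteMeasurableSpace S]
  [MeasurableSpace A] [DiscreteMeasurableSpace A]

instance (M : MDP S A) (π : S → PMF A) (z : S × A) :
    IsProbabilityMeasure (M.trajectory π z) := by
  unfold trajectory; infer_instance

lemma integrable_trajectory (M : MDP S A) (π : S → PMF A) (z : S × A) (f : S × A → ℝ) (t : ℕ) :
    Integrable (fun τ => f (τ t)) (M.trajectory π z) := by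
  have hf : Measurable f := Measurable.of_discrete
  refine Integrable.of_bound (C := ∑ y, |f y|)
    (hf.comp (measurable_pi_apply t)).aestronglyMeasurable (ae_of_all _ fun τ => ?_)
  exact Finset.single_le_sum (f := fun y => |f y|) (fun _ _ => abs_nonneg _)
    (Finset.mem_univ (τ t))

/-- Markov property: condition on the history up to time t, then use that the next coordinate of the
restarted trajectory has law `stepKernel`. -/
lemma integral_trajectory_succ (M : MDP S A) (π : S → PMF A) (z : S × A) (f : S × A → ℝ) (t : ℕ) :
    ∫ τ, f (τ (t + 1)) ∂(M.trajectory π z) =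
      ∫ τ, (M.step π (τ t)).expect f ∂(M.trajectory π z) := by
  have hf : Measurable f := Measurable.of_discrete
  have hg : Measurable fun y : S × A => (M.step π y).expect f := Measurable.of_discrete
  have h1 := M.integrable_trajectory π z f (t + 1)
  unfold trajectory at h1 ⊢
  rw [← Kernel.integral_traj_partialTraj (Nat.zero_le t) h1,
    ← Kernel.traj_map_frestrictLe_apply, integral_map (by fun_prop)]
  · refine integral_congr_ae (ae_of_all _ fun τ => ?_)
    have h2 := Kernel.map_traj_succ_self (X := fun _ : ℕ => S × A)
      (κ := fun n => M.stepKernel π n) (a := t)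
    have h3 : ∀ x, (Kernel.traj (X := fun _ : ℕ => S × A) (fun n => M.stepKernel π n) t x).map
        (fun y => y (t + 1)) = M.stepKernel π t x := fun x => by
      rw [← h2, Kernel.map_apply _ (by fun_prop)]
    have h4 : ∀ x, ∫ y, f (y (t + 1)) ∂(Kernel.traj (X := fun _ : ℕ => S × A)
        (fun n => M.stepKernel π n) t x) = ∫ y, f y ∂(M.stepKernel π t x) := fun x => by
      rw [← h3, integral_map (measurable_pi_apply (t + 1)).aemeasurable hf.aestronglyMeasurable]
    simp only [h4]
    exact PMF.integral_toMeasure _ _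
  · exact Measurable.aestronglyMeasurable (Measurable.of_discrete)

lemma integral_trajectory_zero (M : MDP S A) (π : S → PMF A) (z : S × A) (f : S × A → ℝ) :
    ∫ τ, f (τ 0) ∂(M.trajectory π z) = f z := by
  have hf : Measurable f := Measurable.of_discrete
  unfold trajectory
  rw [Kernel.integral_traj (f := fun τ : ℕ → S × A => f (τ 0)) _
    ((hf.comp (measurable_pi_apply 0)).aestronglyMeasurable)]
  simp [Function.updateFinset]

lemma integral_trajectory (M : MDP S A) (π : S → PMF A) (z : S × A) (f : S × A → ℝ) (t : ℕ) :
    ∫ τ, f (τ t) ∂(M.trajectory π z) = (fun h y => (M.step π y).expect h)^[t] f z := by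
  induction t generalizing f with
  | zero => simpa using M.integral_trajectory_zero π z f
  | succ n ih => rw [integral_trajectory_succ, ih fun y => (M.step π y).expect f, Function.iterate_succ_apply]

/-- Rewards on a finite space are bounded, so geometric domination allows exchanging the sum and the
integral. -/
lemma hasSum_Q (M : MDP S A) (hγ0 : 0 ≤ M.γ) (hγ1 : M.γ < 1) (π : S → PMF A) (z : S × A) :
    HasSum (fun t : ℕ => M.γ ^ t *
      (fun h y => (M.step π y).expect h)^[t] (fun y => M.R y.1 y.2) z) (M.Q π z.1 z.2) := by
  have h := hasSum_integral_of_summable_integral_norm (μ := M.trajectory π z)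
    (F := fun (t : ℕ) τ => M.γ ^ t * M.R (τ t).1 (τ t).2)
    (fun t => (M.integrable_trajectory π z (fun y => M.R y.1 y.2) t).const_mul _) ?_
  · have h2 : ∀ t, ∫ τ, M.γ ^ t * M.R (τ t).1 (τ t).2 ∂(M.trajectory π z) = M.γ ^ t *
      (fun h y => (M.step π y).expect h)^[t] (fun y => M.R y.1 y.2) z := fun t => by
      rw [integral_const_mul, ← M.integral_trajectory π z (fun y => M.R y.1 y.2)]
    rw [funext h2] at h
    exact h
  · refine Summable.of_nonneg_of_le (fun t => integral_nonneg fun τ => norm_nonneg _)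
      (fun t => ?_) ((summable_geometric_of_lt_one hγ0 hγ1).mul_right (∑ y : S × A, |M.R y.1 y.2|))
    simp only [norm_mul, norm_pow, Real.norm_eq_abs, abs_of_nonneg hγ0]
    rw [integral_const_mul]
    refine mul_le_mul_of_nonneg_left ?_ (pow_nonneg hγ0 t)
    refine (integral_mono (M.integrable_trajectory π z (fun y => |M.R y.1 y.2|) t)
      (integrable_const (∑ y : S × A, |M.R y.1 y.2|)) fun τ => ?_).trans_eq (by simp)
    exact Finset.single_le_sum (f := fun y : S × A => |M.R y.1 y.2|) (fun _ _ => abs_nonneg _)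
      (Finset.mem_univ (τ t))

lemma Q_eq_lookahead (M : MDP S A) (hγ0 : 0 ≤ M.γ) (hγ1 : M.γ < 1) (π : S → PMF A) (s : S)
    (a : A) : M.Q π s a = M.lookahead (M.V π) s a := by
  have h := M.hasSum_Q hγ0 hγ1 π (s, a)
  have h1 : HasSum (fun t : ℕ => M.γ * ∑ y, (M.step π (s, a) y).toReal * (M.γ ^ t *
      (fun h y => (M.step π y).expect h)^[t] (fun y => M.R y.1 y.2) y))
      (M.γ * ∑ y, (M.step π (s, a) y).toReal * M.Q π y.1 y.2) :=
    (hasSum_sum fun y _ => (M.hasSum_Q hγ0 hγ1 π y).mul_left _).mul_left _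
  rw [hasSum_nat_add_iff' 1 |>.symm] at h
  simp only [Finset.sum_range_one, pow_zero, Function.iterate_zero, id, one_mul] at h
  have h2 : (fun t : ℕ => M.γ * ∑ y, (M.step π (s, a) y).toReal * (M.γ ^ t *
      (fun h y => (M.step π y).expect h)^[t] (fun y => M.R y.1 y.2) y)) =
      fun t : ℕ => M.γ ^ (t + 1) *
      (fun h y => (M.step π y).expect h)^[t + 1] (fun y => M.R y.1 y.2) (s, a) := by
    funext t
    rw [Function.iterate_succ_apply', PMF.expect, pow_succ', Finset.mul_sum, Finset.mul_sum]
    exact Finset.sum_congr rfl fun y _ => by ring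
  rw [h2] at h1
  have h3 := h.unique h1
  have h4 : ∑ y, (M.step π (s, a) y).toReal * M.Q π y.1 y.2 = (M.P s a).expect (M.V π) :=
    M.expect_step π (s, a) fun y => M.Q π y.1 y.2
  rw [h4] at h3
  unfold lookahead
  linarith

/-- Bellman equation for the value of a policy. -/
theorem V_eq_expect (M : MDP S A) (hγ0 : 0 ≤ M.γ) (hγ1 : M.γ < 1) (π : S → PMF A) (s : S) :
    M.V π s = (π s).expect fun a => M.lookahead (M.V π) s a := by
  simp only [← M.Q_eq_lookahead hγ0 hγ1]
  rfl

end Bellman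

end MDP

/-- Take b to be the maximum of u, at a maximiser. This is the contraction argument behind every
comparison of values below, in a one-sided form that needs no sup norm. -/
lemma le_div_one_sub_of_forall_le {S : Type*} [Finite S] {γ c : ℝ} (hγ1 : γ < 1)
    {u : S → ℝ} (h : ∀ b, (∀ s, u s ≤ b) → ∀ s, u s ≤ c + γ * b) (s : S) :
    u s ≤ c / (1 - γ) := by
  have : Nonempty S := ⟨s⟩
  obtain ⟨t, ht⟩ := Finite.exists_max u
  have h1 := h (u t) ht t
  rw [le_div_iff₀ (by linarith)]
  nlinarith [ht s]

/-! ### Optimal values and comparison principles -/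

namespace MDP

section Optimal

variable {S A : Type*} [Fintype S] (M : MDP S A)

lemma lookahead_sub (v w : S → ℝ) (s : S) (a : A) :
    M.lookahead v s a - M.lookahead w s a = M.γ * (M.P s a).expect fun x => v x - w x := by
  rw [lookahead, lookahead, PMF.expect_sub]
  ring

lemma lookahead_le_add (hγ0 : 0 ≤ M.γ) {v w : S → ℝ} {d : ℝ} (h : ∀ s, v s - w s ≤ d) (s : S)
    (a : A) : M.lookahead v s a ≤ M.lookahead w s a + M.γ * d := by
  have h1 := M.lookahead_sub v w s a
  have h2 := mul_le_mul_of_nonneg_left ((M.P s a).expect_le h) hγ0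
  linarith

/-- The Bellman optimality equation `v(s) = max_a (R(s, a) + γ 𝔼[v(s')])`. -/
structure IsOptimalValue (v : S → ℝ) : Prop where
  lookahead_le : ∀ s a, M.lookahead v s a ≤ v s
  exists_eq : ∀ s, ∃ a, v s = M.lookahead v s a

/-- Banach's fixed point theorem for the Bellman optimality operator. -/
lemma exists_isOptimalValue [Fintype A] [Nonempty A] (hγ0 : 0 ≤ M.γ) (hγ1 : M.γ < 1) :
    ∃ v, M.IsOptimalValue v := by
  let T : (S → ℝ) → S → ℝ := fun v s =>
    Finset.univ.sup' Finset.univ_nonempty fun a => M.lookahead v s a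
  have hle : ∀ v s a, M.lookahead v s a ≤ T v s := fun v s a =>
    Finset.le_sup' (fun a => M.lookahead v s a) (Finset.mem_univ a)
  have hex : ∀ v s, ∃ a, T v s = M.lookahead v s a := fun v s => by
    obtain ⟨a, -, ha⟩ := Finset.exists_mem_eq_sup' Finset.univ_nonempty
      fun a => M.lookahead v s a
    exact ⟨a, ha⟩
  have hsub : ∀ v w s, T v s - T w s ≤ M.γ * dist v w := fun v w s => by
    obtain ⟨a, ha⟩ := hex v s
    have h1 := M.lookahead_le_add hγ0
      (fun x => (le_abs_self _).trans (dist_le_pi_dist v w x)) s a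
    linarith [hle w s a]
  have hT : ContractingWith ⟨M.γ, hγ0⟩ T := by
    refine ⟨hγ1, LipschitzWith.of_dist_le_mul fun v w => ?_⟩
    refine (dist_pi_le_iff (mul_nonneg hγ0 dist_nonneg)).2 fun s => ?_
    rw [Real.dist_eq, abs_sub_le_iff]
    exact ⟨hsub v w s, (hsub w v s).trans_eq (by rw [dist_comm])⟩
  refine ⟨hT.fixedPoint, ?_, ?_⟩
  · intro s a
    exact (hle _ s a).trans_eq (congrFun hT.fixedPoint_isFixedPt s)
  · intro s
    obtain ⟨a, ha⟩ := hex hT.fixedPoint s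
    exact ⟨a, ha ▸ (congrFun hT.fixedPoint_isFixedPt s).symm⟩

variable {M}

/-- A supersolution of the optimality equation dominates every subsolution of the equation of a
policy. -/
lemma le_of_lookahead_le [Fintype A] (hγ0 : 0 ≤ M.γ) (hγ1 : M.γ < 1) {v w : S → ℝ} {π : S → PMF A}
    (hv : ∀ s, v s ≤ (π s).expect fun a => M.lookahead v s a)
    (hw : ∀ s a, M.lookahead w s a ≤ w s) (s : S) : v s ≤ w s := by
  have h := le_div_one_sub_of_forall_le (u := fun s => v s - w s) (c := 0) hγ1
    (fun b hb s => ?_) s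
  · simpa using h
  · have : (π s).expect (fun a => M.lookahead v s a) ≤ w s + M.γ * b :=
      PMF.expect_le _ fun a => (M.lookahead_le_add hγ0 hb s a).trans (by linarith [hw s a])
    linarith [hv s]

variable [Fintype A] [MeasurableSpace S] [DiscreteMeasurableSpace S]
  [MeasurableSpace A] [DiscreteMeasurableSpace A]

lemma IsOptimalValue.V_le {v : S → ℝ} (hv : M.IsOptimalValue v) (hγ0 : 0 ≤ M.γ) (hγ1 : M.γ < 1)
    (π : S → PMF A) (s : S) : M.V π s ≤ v s :=
  le_of_lookahead_le hγ0 hγ1 (fun s => (M.V_eq_expect hγ0 hγ1 π s).le) hv.lookahead_le s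

lemma V_unique (hγ0 : 0 ≤ M.γ) (hγ1 : M.γ < 1) {π : S → PMF A} {v : S → ℝ}
    (hv : ∀ s, v s = (π s).expect fun a => M.lookahead v s a) : v = M.V π := by
  have key : ∀ v w : S → ℝ, (∀ s, v s = (π s).expect fun a => M.lookahead v s a) →
      (∀ s, w s = (π s).expect fun a => M.lookahead w s a) → ∀ s, v s ≤ w s := by
    intro v w hv hw s
    have h := le_div_one_sub_of_forall_le (u := fun s => v s - w s) (c := 0) hγ1
      (fun b hb s => ?_) s
    · simpa using h
    · have : (π s).expect (fun a => M.lookahead v s a - M.lookahead w s a) ≤ M.γ * b :=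
        PMF.expect_le _ fun a => by linarith [M.lookahead_le_add hγ0 hb s a]
      rw [PMF.expect_sub, ← hv, ← hw] at this
      linarith
  have hV := M.V_eq_expect hγ0 hγ1 π
  exact funext fun s => le_antisymm (key _ _ hv hV s) (key _ _ hV hv s)

/-- The greedy deterministic policy works, because v solves its Bellman equation and that solution
is unique. -/
lemma IsOptimalValue.exists_V_eq {v : S → ℝ} (hv : M.IsOptimalValue v) (hγ0 : 0 ≤ M.γ)
    (hγ1 : M.γ < 1) : ∃ π : S → PMF A, M.V π = v := by
  classical
  choose a ha using hv.exists_eq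
  exact ⟨fun s => PMF.pure (a s), (V_unique hγ0 hγ1 fun s => by rw [PMF.expect_pure, ← ha]).symm⟩

lemma IsOptimalValue.eq_optV {v : S → ℝ} (hv : M.IsOptimalValue v) (hγ0 : 0 ≤ M.γ)
    (hγ1 : M.γ < 1) : v = M.optV := by
  obtain ⟨π, hπ⟩ := hv.exists_V_eq hγ0 hγ1
  funext s
  have : Nonempty (S → PMF A) := ⟨π⟩
  refine le_antisymm ?_ (ciSup_le fun π => hv.V_le hγ0 hγ1 π s)
  rw [← hπ]
  exact le_ciSup (f := fun π => M.V π s)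
    ⟨v s, by rintro _ ⟨π, rfl⟩; exact hv.V_le hγ0 hγ1 π s⟩ π

lemma isOptimalValue_optV [Nonempty A] (hγ0 : 0 ≤ M.γ) (hγ1 : M.γ < 1) :
    M.IsOptimalValue M.optV := by
  obtain ⟨v, hv⟩ := M.exists_isOptimalValue hγ0 hγ1
  exact hv.eq_optV hγ0 hγ1 ▸ hv

lemma V_le_optV [Nonempty A] (hγ0 : 0 ≤ M.γ) (hγ1 : M.γ < 1) (π : S → PMF A) (s : S) :
    M.V π s ≤ M.optV s :=
  (isOptimalValue_optV hγ0 hγ1).V_le hγ0 hγ1 π s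

lemma V_nonneg (hγ0 : 0 ≤ M.γ) (hγ1 : M.γ < 1) (hR : ∀ s a, 0 ≤ M.R s a) (π : S → PMF A)
    (s : S) : 0 ≤ M.V π s := by
  have h := le_div_one_sub_of_forall_le (u := fun s => - M.V π s) (c := 0) hγ1
    (fun b hb s => ?_) s
  · simpa using h
  · rw [M.V_eq_expect hγ0 hγ1]
    have : -(M.γ * b) ≤ (π s).expect fun a => M.lookahead (M.V π) s a := by
      refine PMF.le_expect _ fun a => ?_
      have h1 : -b ≤ (M.P s a).expect (M.V π) := PMF.le_expect _ fun x => by linarith [hb x]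
      have h2 := mul_le_mul_of_nonneg_left h1 hγ0
      unfold lookahead
      linarith [hR s a]
    linarith

lemma V_le_one_div (hγ0 : 0 ≤ M.γ) (hγ1 : M.γ < 1) (hR : ∀ s a, M.R s a ≤ 1) (π : S → PMF A)
    (s : S) : M.V π s ≤ 1 / (1 - M.γ) := by
  refine le_div_one_sub_of_forall_le hγ1 (fun b hb s => ?_) s
  rw [M.V_eq_expect hγ0 hγ1]
  refine PMF.expect_le _ fun a => ?_
  have h2 := mul_le_mul_of_nonneg_left ((M.P s a).expect_le hb) hγ0
  unfold lookahead
  linarith [hR s a]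

lemma V_mem_Icc (hγ0 : 0 ≤ M.γ) (hγ1 : M.γ < 1) (hR : ∀ s a, M.R s a ∈ Set.Icc (0 : ℝ) 1)
    (π : S → PMF A) (s : S) : M.V π s ∈ Set.Icc 0 (1 / (1 - M.γ)) :=
  ⟨V_nonneg hγ0 hγ1 (fun s a => (hR s a).1) π s, V_le_one_div hγ0 hγ1 (fun s a => (hR s a).2) π s⟩

lemma optV_mem_Icc [Nonempty A] (hγ0 : 0 ≤ M.γ) (hγ1 : M.γ < 1)
    (hR : ∀ s a, M.R s a ∈ Set.Icc (0 : ℝ) 1) (s : S) :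
    M.optV s ∈ Set.Icc 0 (1 / (1 - M.γ)) := by
  obtain ⟨π, hπ⟩ := (isOptimalValue_optV (M := M) hγ0 hγ1).exists_V_eq hγ0 hγ1
  rw [← hπ]
  exact V_mem_Icc hγ0 hγ1 hR π s

end Optimal

/-! ### Absorbing MDPs: removing the dependence on one state -/

section Absorb

variable {S A : Type*} [DecidableEq S]

/-- The MDP in which the state `s₀` is made absorbing with value `u`. -/
noncomputable def absorb (M : MDP S A) (s₀ : S) (u : ℝ) : MDP S A where
  P s a := if s = s₀ then PMF.pure s₀ else M.P s a
  R s a := if s = s₀ then (1 - M.γ) * u else M.R s a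
  γ := M.γ

/-- Source of independence: an absorbing empirical model is unaffected by the samples drawn at `s₀`.
-/
lemma absorb_congr {M M' : MDP S A} {s₀ : S} (u : ℝ) (hP : ∀ s ≠ s₀, M.P s = M'.P s)
    (hR : M.R = M'.R) (hγ : M.γ = M'.γ) : M.absorb s₀ u = M'.absorb s₀ u := by
  simp only [absorb, hR, hγ, MDP.mk.injEq, and_true]
  funext s a
  split_ifs with h
  · rfl
  · rw [hP s h]

lemma absorb_R_mem_Icc {M : MDP S A} (hγ1 : M.γ < 1) (hR : ∀ s a, M.R s a ∈ Set.Icc (0 : ℝ) 1)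
    {s₀ : S} {u : ℝ} (hu : u ∈ Set.Icc 0 (1 / (1 - M.γ))) (s : S) (a : A) :
    (M.absorb s₀ u).R s a ∈ Set.Icc (0 : ℝ) 1 := by
  simp only [absorb]
  split_ifs with h
  · have h1 : 0 < 1 - M.γ := by linarith
    refine ⟨mul_nonneg h1.le hu.1, ?_⟩
    have := mul_le_mul_of_nonneg_left hu.2 h1.le
    rwa [mul_one_div_cancel h1.ne'] at this
  · exact hR s a

variable [Fintype S] [Fintype A] [Nonempty A] [MeasurableSpace S] [DiscreteMeasurableSpace S]
  [MeasurableSpace A] [DiscreteMeasurableSpace A]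

/-- The optimal value of the absorbing MDP is `1`-Lipschitz in the value of the absorbing state,
and equal to that of the original MDP when that value is the optimal one. -/
lemma abs_optV_sub_optV_absorb_le {M : MDP S A} (hγ0 : 0 ≤ M.γ) (hγ1 : M.γ < 1) (s₀ : S) (u : ℝ)
    (s : S) : |M.optV s - (M.absorb s₀ u).optV s| ≤ |M.optV s₀ - u| := by
  have h1 : M.IsOptimalValue M.optV := isOptimalValue_optV hγ0 hγ1
  have h2 : (M.absorb s₀ u).IsOptimalValue (M.absorb s₀ u).optV :=
    isOptimalValue_optV hγ0 hγ1
  set v := M.optV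
  set w := (M.absorb s₀ u).optV
  have hw : w s₀ = u := by
    obtain ⟨a, ha⟩ := h2.exists_eq s₀
    simp only [lookahead, absorb, if_pos, PMF.expect_pure] at ha
    have : (1 - M.γ) * (w s₀ - u) = 0 := by linarith
    rcases mul_eq_zero.1 this with h | h <;> linarith
  have hl : ∀ f x a, x ≠ s₀ → (M.absorb s₀ u).lookahead f x a = M.lookahead f x a := by
    intro f x a hx
    simp [lookahead, absorb, hx]
  set c := |v s₀ - u|
  have hc : 0 ≤ c := abs_nonneg _
  -- Maximum principle: if the maximum of f - g is attained away from `s₀`, then it is at most γ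
  -- times itself, hence nonpositive.
  have key : ∀ f g : S → ℝ, f s₀ - g s₀ ≤ c →
      (∀ x ≠ s₀, ∃ a, f x = M.lookahead f x a ∧ M.lookahead g x a ≤ g x) →
      ∀ x, f x - g x ≤ c := by
    intro f g h0 h x
    have : Nonempty S := ⟨s₀⟩
    obtain ⟨y, hy⟩ := Finite.exists_max fun x => f x - g x
    refine (hy x).trans ?_
    by_cases hys : y = s₀
    · rw [hys]; exact h0
    · obtain ⟨a, ha, hb⟩ := h y hys
      have h3 := M.lookahead_le_add hγ0 hy y a
      have h4 : (1 - M.γ) * (f y - g y) ≤ 0 := by linarith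
      have h5 : f y - g y ≤ 0 := by
        by_contra hcon
        push Not at hcon
        have := mul_pos (sub_pos.2 hγ1) hcon
        linarith
      linarith
  refine abs_sub_le_iff.2 ⟨key v w (by rw [hw]; exact le_abs_self _) (fun x hx => ?_) s,
    key w v (by rw [hw]; exact (le_abs_self _).trans_eq (abs_sub_comm _ _)) (fun x hx => ?_) s⟩
  · obtain ⟨a, ha⟩ := h1.exists_eq x
    exact ⟨a, ha, by rw [← hl _ _ _ hx]; exact h2.lookahead_le x a⟩
  · obtain ⟨a, ha⟩ := h2.exists_eq x
    exact ⟨a, by rw [← hl _ _ _ hx]; exact ha, h1.lookahead_le x a⟩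

end Absorb

end MDP

/-! ### Grouping: equality of values and minimal deviation factors -/

namespace MDP

section GroupedValue

variable {S A G : Type*} [Fintype S] [Fintype A] [Fintype G]

omit [Fintype G] in
lemma grouped_lookahead (M : MDP S A) (πi : G → PMF A) (v : S → ℝ) (s : S) (h : G) :
    (M.grouped πi).lookahead v s h = (πi h).expect fun a => M.lookahead v s a := by
  unfold lookahead
  rw [PMF.expect_add, PMF.expect_const_mul]
  simp only [grouped, PMF.expect_bind]
  rfl

lemma V_jointPolicy [MeasurableSpace S] [DiscreteMeasurableSpace S]
    [MeasurableSpace A] [DiscreteMeasurableSpace A] [MeasurableSpace G] [DiscreteMeasurableSpace G]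
    (M : MDP S A) (hγ0 : 0 ≤ M.γ) (hγ1 : M.γ < 1) (πo : S → PMF G) (πi : G → PMF A) :
    M.V (jointPolicy πo πi) = (M.grouped πi).V πo := by
  refine (V_unique (M := M) hγ0 hγ1 fun s => ?_).symm
  rw [V_eq_expect (M.grouped πi) hγ0 hγ1 πo s, jointPolicy, PMF.expect_bind]
  simp only [grouped_lookahead]

end GroupedValue

section Deviation

variable {S A G : Type*} [Fintype S] [Fintype A] [Fintype G] (M : MDP S A) (g : A → G)

/-- The common part `min_{g(a) = h} P(s'|s, a)` of the transition kernels of a group. -/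
noncomputable def minP (s : S) (h : G) (s' : S) : ℝ :=
  ⨅ a : {a : A // g a = h}, (M.P s a s').toReal

variable {g} in
omit [Fintype S] [Fintype G] in
lemma minP_le (s : S) (a : A) (s' : S) : M.minP g s (g a) s' ≤ (M.P s a s').toReal :=
  ciInf_le (f := fun b : {b : A // g b = g a} => (M.P s b s').toReal)
    (Set.finite_range _).bddBelow ⟨a, rfl⟩

omit [Fintype S] [Fintype A] [Fintype G] in
lemma minP_nonneg (s : S) (h : G) (s' : S) : 0 ≤ M.minP g s h s' :=
  Real.iInf_nonneg fun _ => ENNReal.toReal_nonneg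

omit [Fintype A] in
lemma one_sub_sum_minP_le_betaP (s : S) (h : G) : 1 - ∑ s', M.minP g s h s' ≤ M.betaP g :=
  sub_le_sub_left (ciInf_le (f := fun z : S × G => ∑ s', M.minP g z.1 z.2 s')
    (Set.finite_range _).bddBelow (s, h)) 1

omit [Fintype A] in
lemma betaP_eq_iSup [Nonempty S] [Nonempty G] :
    M.betaP g = ⨆ z : S × G, (1 - ∑ s', M.minP g z.1 z.2 s') := by
  refine le_antisymm ?_ (ciSup_le fun z => M.one_sub_sum_minP_le_betaP g z.1 z.2)
  obtain ⟨z, hz⟩ := exists_eq_ciInf_of_finite (f := fun z : S × G => ∑ s', M.minP g z.1 z.2 s')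
  refine le_trans (le_of_eq ?_) (le_ciSup (Set.finite_range _).bddAbove z)
  rw [hz]
  rfl

omit [Fintype G] in
lemma sub_le_betaR (s : S) {a₁ a₂ : A} (h : g a₁ = g a₂) : M.R s a₁ - M.R s a₂ ≤ M.betaR g :=
  le_ciSup (f := fun z : S × {p : A × A // g p.1 = g p.2} => M.R z.1 z.2.1.1 - M.R z.1 z.2.1.2)
    (Set.finite_range _).bddAbove (s, ⟨(a₁, a₂), h⟩)

variable {g}

omit [Fintype G] in
lemma sum_minP_le_one (hg : Function.Surjective g) (s : S) (h : G) :
    ∑ s', M.minP g s h s' ≤ 1 := by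
  obtain ⟨a, rfl⟩ := hg h
  rw [← (M.P s a).sum_toReal]
  exact Finset.sum_le_sum fun s' _ => M.minP_le s a s'

lemma iSup_comp_group {S A G : Type*} {g : A → G} (hg : Function.Surjective g) (f : S → G → ℝ) :
    ⨆ z : S × A, f z.1 (g z.2) = ⨆ z : S × G, f z.1 z.2 :=
  (Function.Surjective.prodMap Function.surjective_id hg).iSup_comp (fun z : S × G => f z.1 z.2)

/-- `P₁` is the normalised common part of a group, of mass m, and `P₂` the normalised remainder. The
weight 1 - m depends on the group only. -/
lemma betaP_mem [Nonempty S] [Nonempty G] (hg : Function.Surjective g) :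
    M.betaP g ∈ M.probDeviationFactors g := by
  set m : S → G → ℝ := fun s h => ∑ s', M.minP g s h s' with hm
  have hm0 : ∀ s h, 0 ≤ m s h := fun s h => Finset.sum_nonneg fun s' _ => M.minP_nonneg g s h s'
  have hm1 : ∀ s h, m s h ≤ 1 := M.sum_minP_le_one hg
  have hP1 : ∀ s h, ∃ p : PMF S, ∀ s', M.minP g s h s' = m s h * (p s').toReal := fun s h => by
    -- If the common mass vanishes, so does every term of it, and any distribution can serve as
    -- `P₁`.
    rcases (hm0 s h).eq_or_lt with h0 | h0
    · obtain ⟨a, -⟩ := hg h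
      refine ⟨M.P s a, fun s' => ?_⟩
      rw [← h0, zero_mul]
      exact (Finset.sum_eq_zero_iff_of_nonneg fun s' _ => M.minP_nonneg g s h s').1 h0.symm s'
        (Finset.mem_univ _)
    · obtain ⟨p, hp⟩ := PMF.exists_toReal_eq (fun s' => M.minP g s h s' / m s h)
        (fun s' => div_nonneg (M.minP_nonneg g s h s') h0.le)
        (by rw [← Finset.sum_div, div_self h0.ne'])
      exact ⟨p, fun s' => by rw [hp]; field_simp⟩
  have hP2 : ∀ s a, ∃ p : PMF S, ∀ s', (M.P s a s').toReal - M.minP g s (g a) s' =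
      (1 - m s (g a)) * (p s').toReal := fun s a => by
    have hsum : ∑ s', ((M.P s a s').toReal - M.minP g s (g a) s') = 1 - m s (g a) := by
      rw [Finset.sum_sub_distrib, PMF.sum_toReal]
    have hnn : ∀ s', 0 ≤ (M.P s a s').toReal - M.minP g s (g a) s' := fun s' =>
      sub_nonneg.2 (M.minP_le s a s')
    rcases (sub_nonneg.2 (hm1 s (g a))).eq_or_lt with h0 | h0
    · refine ⟨M.P s a, fun s' => ?_⟩
      rw [← h0, zero_mul]
      exact (Finset.sum_eq_zero_iff_of_nonneg fun s' _ => hnn s').1 (hsum.trans h0.symm) s'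
        (Finset.mem_univ _)
    · obtain ⟨p, hp⟩ := PMF.exists_toReal_eq
        (fun s' => ((M.P s a s').toReal - M.minP g s (g a) s') / (1 - m s (g a)))
        (fun s' => div_nonneg (hnn s') h0.le)
        (by rw [← Finset.sum_div, hsum, div_self h0.ne'])
      exact ⟨p, fun s' => by rw [hp]; field_simp⟩
  choose P₁ hP₁ using hP1
  choose P₂ hP₂ using hP2
  refine ⟨fun s a => 1 - m s (g a), P₁, P₂, fun s a => ⟨sub_nonneg.2 (hm1 _ _), by
    linarith [hm0 s (g a)]⟩, fun s a s' => ?_, ?_⟩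
  · linarith [hP₁ s (g a) s', hP₂ s a s']
  · rw [betaP_eq_iSup]
    exact (iSup_comp_group hg fun s h => 1 - m s h).symm

theorem isLeast_betaP [Nonempty S] [Nonempty G] (hg : Function.Surjective g) :
    IsLeast (M.probDeviationFactors g) (M.betaP g) := by
  refine ⟨M.betaP_mem hg, ?_⟩
  rintro β ⟨b, P₁, P₂, hb, hP, rfl⟩
  rw [betaP_eq_iSup]
  refine ciSup_le fun z => ?_
  obtain ⟨s, h⟩ := z
  set β := ⨆ z : S × A, b z.1 z.2
  have hβ : ∀ a, b s a ≤ β := fun a =>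
    le_ciSup (f := fun z : S × A => b z.1 z.2) (Set.finite_range _).bddAbove (s, a)
  -- In any decomposition (1 - β) P₁ lies below every kernel of the group, hence below their
  -- minimum; summing over s' then gives the bound.
  have h1 : ∀ s', (1 - β) * (P₁ s h s').toReal ≤ M.minP g s h s' := fun s' => by
    obtain ⟨a₀, ha₀⟩ := hg h
    have : Nonempty {a : A // g a = h} := ⟨⟨a₀, ha₀⟩⟩
    refine le_ciInf fun ⟨a, ha⟩ => ?_
    subst ha
    rw [hP]
    have h2 : 0 ≤ (P₁ s (g a) s').toReal := ENNReal.toReal_nonneg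
    have h3 := mul_nonneg (hb s a).1 (ENNReal.toReal_nonneg (a := P₂ s a s'))
    nlinarith [hβ a]
  have h4 := Finset.sum_le_sum fun s' (_ : s' ∈ Finset.univ) => h1 s'
  rw [← Finset.mul_sum, PMF.sum_toReal] at h4
  show 1 - ∑ s', M.minP g s h s' ≤ β
  linarith

/-- With d the spread of rewards in a group, the witnesses are R₁ = min/(1 - d) and R₂ = (R -
min)/d. R₁ ≤ 1 because the maximum min + d is at most 1. -/
lemma betaR_mem [Nonempty S] [Nonempty G] (hg : Function.Surjective g)
    (hR : ∀ s a, M.R s a ∈ Set.Icc (0 : ℝ) 1) :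
    M.betaR g ∈ M.rewardDeviationFactors g := by
  have hmax : ∀ s h, ∃ a, g a = h ∧ ∀ a', g a' = h → M.R s a' ≤ M.R s a := fun s h => by
    obtain ⟨a₀, ha₀⟩ := hg h
    have : Nonempty {a : A // g a = h} := ⟨⟨a₀, ha₀⟩⟩
    obtain ⟨a, ha⟩ := Finite.exists_max fun a : {a : A // g a = h} => M.R s a
    exact ⟨a, a.2, fun a' h' => ha ⟨a', h'⟩⟩
  have hmin : ∀ s h, ∃ a, g a = h ∧ ∀ a', g a' = h → M.R s a ≤ M.R s a' := fun s h => by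
    obtain ⟨a₀, ha₀⟩ := hg h
    have : Nonempty {a : A // g a = h} := ⟨⟨a₀, ha₀⟩⟩
    obtain ⟨a, ha⟩ := Finite.exists_min fun a : {a : A // g a = h} => M.R s a
    exact ⟨a, a.2, fun a' h' => ha ⟨a', h'⟩⟩
  choose hi hi_mem hi_le using hmax
  choose lo lo_mem le_lo using hmin
  set d : S → G → ℝ := fun s h => M.R s (hi s h) - M.R s (lo s h) with hd
  have hd0 : ∀ s h, 0 ≤ d s h := fun s h => sub_nonneg.2 (hi_le s h _ (lo_mem s h))
  have hd1 : ∀ s h, d s h ≤ 1 := fun s h => by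
    simp only [hd]
    linarith [(hR s (hi s h)).2, (hR s (lo s h)).1]
  have hR1 : ∀ s h, ∃ r ∈ Set.Icc (0 : ℝ) 1, M.R s (lo s h) = (1 - d s h) * r := fun s h => by
    -- A spread of 1 forces the minimum to be 0, so the vanishing weight 1 - d is harmless.
    rcases (sub_nonneg.2 (hd1 s h)).eq_or_lt with h0 | h0
    · refine ⟨0, by simp, ?_⟩
      have h1 : d s h = M.R s (hi s h) - M.R s (lo s h) := rfl
      linarith [(hR s (hi s h)).2, (hR s (lo s h)).1]
    · refine ⟨M.R s (lo s h) / (1 - d s h), ⟨div_nonneg (hR _ _).1 h0.le, ?_⟩, by field_simp⟩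
      rw [div_le_one h0]
      have h1 : d s h = M.R s (hi s h) - M.R s (lo s h) := rfl
      linarith [(hR s (hi s h)).2]
  have hR2 : ∀ s a, ∃ r ∈ Set.Icc (0 : ℝ) 1, M.R s a - M.R s (lo s (g a)) = d s (g a) * r := by
    intro s a
    have h1 : d s (g a) = M.R s (hi s (g a)) - M.R s (lo s (g a)) := rfl
    have h2 := hi_le s (g a) a rfl
    have h3 := le_lo s (g a) a rfl
    rcases (hd0 s (g a)).eq_or_lt with h0 | h0
    · exact ⟨0, by simp, by linarith⟩
    · refine ⟨(M.R s a - M.R s (lo s (g a))) / d s (g a), ⟨div_nonneg (by linarith) h0.le, ?_⟩,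
        by field_simp⟩
      rw [div_le_one h0]
      linarith
  choose R₁ hR₁ hR₁' using hR1
  choose R₂ hR₂ hR₂' using hR2
  refine ⟨fun s a => d s (g a), R₁, R₂, fun s a => ⟨hd0 _ _, hd1 _ _⟩, hR₁, hR₂,
    fun s a => ?_, ?_⟩
  · linarith [hR₁' s (g a), hR₂' s a]
  · rw [iSup_comp_group hg fun s h => d s h]
    obtain ⟨a₀, -⟩ := hg (Classical.arbitrary G)
    have : Nonempty (S × {p : A × A // g p.1 = g p.2}) :=
      ⟨Classical.arbitrary S, ⟨(a₀, a₀), rfl⟩⟩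
    refine le_antisymm (ciSup_le fun ⟨s, ⟨⟨a₁, a₂⟩, h⟩⟩ => ?_) (ciSup_le fun ⟨s, h⟩ =>
      M.sub_le_betaR g s ((hi_mem s h).trans (lo_mem s h).symm))
    refine le_trans ?_ (le_ciSup (f := fun z : S × G => d z.1 z.2)
      (Set.finite_range _).bddAbove (s, g a₁))
    have h1 := hi_le s (g a₁) a₁ rfl
    have h2 := le_lo s (g a₁) a₂ h.symm
    simp only [hd]
    linarith

theorem isLeast_betaR [Nonempty S] [Nonempty G] (hg : Function.Surjective g)
    (hR : ∀ s a, M.R s a ∈ Set.Icc (0 : ℝ) 1) :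
    IsLeast (M.rewardDeviationFactors g) (M.betaR g) := by
  refine ⟨M.betaR_mem hg hR, ?_⟩
  rintro β ⟨b, R₁, R₂, hb, hR₁, hR₂, h, rfl⟩
  obtain ⟨a₀, -⟩ := hg (Classical.arbitrary G)
  have : Nonempty (S × {p : A × A // g p.1 = g p.2}) :=
    ⟨Classical.arbitrary S, ⟨(a₀, a₀), rfl⟩⟩
  refine ciSup_le fun ⟨s, ⟨⟨a₁, a₂⟩, ha⟩⟩ => ?_
  set β := ⨆ z : S × A, b z.1 z.2
  have hβ : ∀ a, b s a ≤ β := fun a =>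
    le_ciSup (f := fun z : S × A => b z.1 z.2) (Set.finite_range _).bddAbove (s, a)
  show M.R s a₁ - M.R s a₂ ≤ β
  have ha' : g a₁ = g a₂ := ha
  rw [h s a₁, h s a₂, ha']
  -- With r the common value of `R₁` and the worst cases R₂ = 1 and R₂ = 0, the difference is at
  -- most b₁(1 - r) + b₂ r, a convex combination of b₁ and b₂.
  have h1 := mul_nonneg (hb s a₁).1 (sub_nonneg.2 (hR₂ s a₁).2)
  have h2 := mul_nonneg (hb s a₂).1 (hR₂ s a₂).1
  have h3 := mul_nonneg (sub_nonneg.2 (hβ a₁)) (sub_nonneg.2 (hR₁ s (g a₂)).2)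
  have h4 := mul_nonneg (sub_nonneg.2 (hβ a₂)) (hR₁ s (g a₂)).1
  linarith

section Approximation

variable {πi : G → PMF A} (hπi : ∀ h, ∀ a ∈ (πi h).support, g a = h)
include hπi

/-- Both kernels dominate the common part of the group. The first exceeds it by mass at most
`betaP`, on which v is at most B; the excess of the second contributes a nonnegative amount. -/
lemma expect_sub_expect_grouped_le (s : S) (a : A) {v : S → ℝ} {B : ℝ}
    (hv : ∀ x, v x ∈ Set.Icc 0 B) :
    (M.P s a).expect v - ((M.grouped πi).P s (g a)).expect v ≤ M.betaP g * B := by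
  obtain hB : 0 ≤ B := (hv s).1.trans (hv s).2
  have h1 : (M.P s a).expect v ≤ B * (1 - ∑ x, M.minP g s (g a) x) +
      ∑ x, M.minP g s (g a) x * v x := by
    rw [← (M.P s a).sum_toReal, ← Finset.sum_sub_distrib, Finset.mul_sum,
      ← Finset.sum_add_distrib]
    refine Finset.sum_le_sum fun x _ => ?_
    have := mul_nonneg (sub_nonneg.2 (M.minP_le (g := g) s a x)) (sub_nonneg.2 (hv x).2)
    linarith
  have h2 : ∑ x, M.minP g s (g a) x * v x ≤ ((M.grouped πi).P s (g a)).expect v := by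
    rw [grouped, PMF.expect_bind]
    refine (PMF.expect_const (πi (g a)) _).symm.le.trans
      (PMF.expect_mono_of_mem_support _ fun b hb => ?_)
    rw [← hπi _ b hb]
    exact Finset.sum_le_sum fun x _ => mul_le_mul_of_nonneg_right (M.minP_le s b x) (hv x).1
  have h3 := mul_le_mul_of_nonneg_left (M.one_sub_sum_minP_le_betaP g s (g a)) hB
  linarith

omit [Fintype G] in
lemma R_sub_R_grouped_le (s : S) (a : A) :
    M.R s a - (M.grouped πi).R s (g a) ≤ M.betaR g := by
  have h1 : (πi (g a)).expect (fun b => M.R s a - M.R s b) ≤ (πi (g a)).expect fun _ => M.betaR g :=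
    PMF.expect_mono_of_mem_support _ fun b hb => M.sub_le_betaR g s (hπi _ b hb).symm
  rw [PMF.expect_sub, PMF.expect_const, PMF.expect_const] at h1
  exact h1

variable [MeasurableSpace S] [DiscreteMeasurableSpace S]
    [MeasurableSpace A] [DiscreteMeasurableSpace A] [MeasurableSpace G] [DiscreteMeasurableSpace G]

/-- Loss of optimality caused by the grouping. -/
theorem optV_sub_optV_grouped_le [Nonempty A] [Nonempty G] (hγ0 : 0 ≤ M.γ) (hγ1 : M.γ < 1)
    (hR : ∀ s a, M.R s a ∈ Set.Icc (0 : ℝ) 1) (s : S) :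
    M.optV s - (M.grouped πi).optV s ≤
      M.γ * M.betaP g / (1 - M.γ) ^ 2 + M.betaR g / (1 - M.γ) := by
  have h1 : M.IsOptimalValue M.optV := isOptimalValue_optV hγ0 hγ1
  have h2 : (M.grouped πi).IsOptimalValue (M.grouped πi).optV := isOptimalValue_optV hγ0 hγ1
  have h3 := le_div_one_sub_of_forall_le (u := fun s => M.optV s - (M.grouped πi).optV s)
    (c := M.betaR g + M.γ * (M.betaP g * (1 / (1 - M.γ)))) hγ1 (fun b hb s => ?_) s
  · refine h3.trans_eq ?_
    have : 1 - M.γ ≠ 0 := by linarith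
    field_simp
    ring
  · obtain ⟨a, ha⟩ := h1.exists_eq s
    have h4 := M.expect_sub_expect_grouped_le hπi s a (optV_mem_Icc hγ0 hγ1 hR)
    have h5 := M.R_sub_R_grouped_le hπi s a
    have h6 := (M.grouped πi).lookahead_le_add hγ0 hb s (g a)
    have h7 := h2.lookahead_le s (g a)
    have h8 := mul_le_mul_of_nonneg_left h4 hγ0
    have h9 : (M.grouped πi).lookahead M.optV s (g a) =
      (M.grouped πi).R s (g a) + M.γ * ((M.grouped πi).P s (g a)).expect M.optV := rfl
    have h10 : (M.grouped πi).γ = M.γ := rfl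
    rw [h10] at h6
    have h11 : M.optV s = M.R s a + M.γ * (M.P s a).expect M.optV := ha
    linarith

end Approximation

end Deviation

end MDP

/-! ### Variance and Bernstein's inequality -/

namespace PMF

section Var

variable {α : Type*} [Fintype α]

/-- Variance of a real function under a probability mass function on a finite type. -/
noncomputable def var (p : PMF α) (f : α → ℝ) : ℝ := p.expect fun a => (f a - p.expect f) ^ 2

lemma var_nonneg (p : PMF α) (f : α → ℝ) : 0 ≤ p.var f :=
  p.le_expect fun _ => sq_nonneg _

lemma expect_sub_const_sq (p : PMF α) (f : α → ℝ) (c : ℝ) :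
    p.expect (fun a => (f a - c) ^ 2) = p.expect (fun a => f a ^ 2) - 2 * c * p.expect f + c ^ 2 := by
  have : (fun a => (f a - c) ^ 2) = fun a => (f a ^ 2 - (2 * c) * f a) + c ^ 2 :=
    funext fun a => by ring
  rw [this, expect_add, expect_sub, expect_const_mul, expect_const]

lemma var_eq (p : PMF α) (f : α → ℝ) :
    p.var f = p.expect (fun a => f a ^ 2) - p.expect f ^ 2 := by
  rw [var, expect_sub_const_sq]
  ring

lemma sq_expect_le (p : PMF α) (f : α → ℝ) : p.expect f ^ 2 ≤ p.expect fun a => f a ^ 2 := by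
  linarith [p.var_nonneg f, p.var_eq f]

lemma var_le_expect_sub_sq (p : PMF α) (f : α → ℝ) (c : ℝ) :
    p.var f ≤ p.expect fun a => (f a - c) ^ 2 := by
  rw [var_eq, expect_sub_const_sq]
  nlinarith [sq_nonneg (p.expect f - c)]

lemma var_le_of_mem_Icc (p : PMF α) {f : α → ℝ} {B : ℝ} (h : ∀ a, f a ∈ Set.Icc 0 B) :
    p.var f ≤ B ^ 2 / 4 :=
  (p.var_le_expect_sub_sq f (B / 2)).trans <| p.expect_le fun a => by
    nlinarith [mul_nonneg (h a).1 (sub_nonneg.2 (h a).2)]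

lemma var_neg (p : PMF α) (f : α → ℝ) : p.var (fun a => -f a) = p.var f := by
  have : p.expect (fun a => -f a) = -p.expect f := by simp [expect]
  simp only [var, this]
  congr 1
  funext a
  ring

/-- The standard deviation changes by at most `e` under a perturbation of size `e`. -/
lemma sqrt_var_le_add (p : PMF α) {f g : α → ℝ} {e : ℝ} (h : ∀ a, |f a - g a| ≤ e) :
    √(p.var f) ≤ √(p.var g) + e := by
  obtain ⟨a₀, -⟩ := p.support_nonempty
  have he : 0 ≤ e := (abs_nonneg _).trans (h a₀)
  set x : α → ℝ := fun a => g a - p.expect g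
  set y : α → ℝ := fun a => (f a - g a) - p.expect fun a => f a - g a
  have hx : p.var g = p.expect fun a => x a ^ 2 := rfl
  have hy : p.expect (fun a => y a ^ 2) ≤ e ^ 2 :=
    (p.var_le_expect_sub_sq (fun a => f a - g a) 0).trans <| p.expect_le fun a => by
      rw [sub_zero, ← sq_abs]
      exact pow_le_pow_left₀ (abs_nonneg _) (h a) 2
  -- Cauchy–Schwarz in L²(p), reduced to the Euclidean one by splitting the weights as √p · √p.
  have hxy : p.expect (fun a => x a * y a) ≤ √(p.var g) * e := by
    refine Real.le_sqrt_of_sq_le ?_ |>.trans (b := √(p.var g * e ^ 2)) ?_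
    · have h1 := Finset.sum_mul_sq_le_sq_mul_sq Finset.univ (fun a => √(p a).toReal * x a)
        (fun a => √(p a).toReal * y a)
      have h2 : ∀ u v : α → ℝ, ∑ a, (√(p a).toReal * u a) * (√(p a).toReal * v a) =
          p.expect fun a => u a * v a := fun u v => Finset.sum_congr rfl fun a _ => by
        rw [mul_mul_mul_comm, Real.mul_self_sqrt ENNReal.toReal_nonneg]
      simp only [pow_two (√ _ * _), h2] at h1
      refine h1.trans ?_
      simp only [← pow_two, ← hx]
      exact mul_le_mul_of_nonneg_left hy (p.var_nonneg g)
    · rw [Real.sqrt_mul (p.var_nonneg g), Real.sqrt_sq he]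
  have hf : p.var f = p.var g + 2 * p.expect (fun a => x a * y a) + p.expect fun a => y a ^ 2 := by
    rw [hx, ← expect_const_mul, ← expect_add, ← expect_add, var]
    congr 1
    funext a
    simp only [x, y, expect_sub]
    ring
  rw [Real.sqrt_le_left (by positivity), hf]
  nlinarith [Real.sq_sqrt (p.var_nonneg g)]

/-- Use exp x ≤ 1 + x + x² for |x| ≤ 1: the linear term averages to zero, and 1 + y ≤ exp y. -/
lemma expect_exp_le (p : PMF α) {f : α → ℝ} {B t : ℝ} (hB : ∀ a, |f a - p.expect f| ≤ B)
    (ht : 0 ≤ t) (htB : t * B ≤ 1) :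
    p.expect (fun a => Real.exp (t * (f a - p.expect f))) ≤ Real.exp (t ^ 2 * p.var f) := by
  have h1 : ∀ a, Real.exp (t * (f a - p.expect f)) ≤
      (1 + t * (f a - p.expect f)) + t ^ 2 * (f a - p.expect f) ^ 2 := fun a => by
    have h2 : |t * (f a - p.expect f)| ≤ 1 := by
      rw [abs_mul, abs_of_nonneg ht]
      exact (mul_le_mul_of_nonneg_left (hB a) ht).trans htB
    have h3 := (abs_le.1 (Real.abs_exp_sub_one_sub_id_le h2)).2
    rw [mul_pow] at h3
    linarith
  refine (p.expect_mono h1).trans ?_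
  rw [expect_add, expect_add, expect_const_mul, expect_const_mul, expect_const, expect_sub,
    expect_const]
  have := Real.add_one_le_exp (t ^ 2 * p.var f)
  rw [var] at this ⊢
  linarith

end Var

end PMF

section Bernstein

variable {S Ω : Type*} [Fintype S] [MeasurableSpace S] [DiscreteMeasurableSpace S]
  [MeasurableSpace Ω] {μ : Measure Ω} [IsProbabilityMeasure μ] {N : ℕ}

/-- Bernstein's inequality for the upper deviation of an empirical mean. -/
lemma measureReal_bernstein_le (hN : 0 < N) {Y : Fin N → Ω → S} {p : PMF S}
    (hm : ∀ k, Measurable (Y k)) (hlaw : ∀ k, μ.map (Y k) = p.toMeasure) (hind : iIndepFun Y μ)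
    {f : S → ℝ} {B q : ℝ} (hB : ∀ s, |f s - p.expect f| ≤ B) (hB0 : 0 < B) (hq : 0 < q) :
    μ.real {ω | 2 * √(p.var f) * q + B * q ^ 2 ≤ (∑ k, f (Y k ω)) / N - p.expect f} ≤
      Real.exp (-(N * q ^ 2)) := by
  have hN' : (0 : ℝ) < N := Nat.cast_pos.2 hN
  set σ := √(p.var f)
  have hσ0 : 0 ≤ σ := Real.sqrt_nonneg _
  have hσ : σ ^ 2 = p.var f := Real.sq_sqrt (p.var_nonneg f)
  set r := 2 * σ * q + B * q ^ 2
  -- Chernoff parameter: t = q/σ optimises the Gaussian regime, and t = 1/B is used when that would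
  -- violate tB ≤ 1. The last condition makes the Chernoff exponent at most -N q².
  obtain ⟨t, ht0, htB, ht⟩ : ∃ t : ℝ, 0 ≤ t ∧ t * B ≤ 1 ∧ t ^ 2 * σ ^ 2 + q ^ 2 ≤ t * r := by
    rcases le_or_gt (B * q) σ with h | h
    · have hσ1 : 0 < σ := lt_of_lt_of_le (mul_pos hB0 hq) h
      refine ⟨q / σ, by positivity, ?_, ?_⟩
      · rw [div_mul_eq_mul_div, div_le_one hσ1]
        linarith
      · have e1 : (q / σ) ^ 2 * σ ^ 2 = q ^ 2 := by field_simp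
        have e2 : q / σ * r = 2 * q ^ 2 + q / σ * (B * q ^ 2) := by
          simp only [r]
          field_simp
        have : 0 ≤ q / σ * (B * q ^ 2) := by positivity
        linarith
    · refine ⟨1 / B, by positivity, by field_simp; rfl, ?_⟩
      have e1 : (1 / B) ^ 2 * σ ^ 2 = (σ / B) * (σ / B) := by field_simp
      have e2 : 1 / B * r = 2 * (σ / B) * q + q ^ 2 := by
        simp only [r]
        field_simp
      have h1 : σ / B ≤ q := by
        rw [div_le_iff₀ hB0]
        linarith
      have h0 : 0 ≤ σ / B := by positivity
      nlinarith
  set Z : Fin N → Ω → ℝ := fun k ω => f (Y k ω) - p.expect f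
  have hfm : Measurable fun s => f s - p.expect f := Measurable.of_discrete
  have hZm : ∀ k, Measurable (Z k) := fun k => hfm.comp (hm k)
  have hZind : iIndepFun Z μ := hind.comp (fun _ s => f s - p.expect f) fun _ => hfm
  have hmgf : ∀ k, mgf (Z k) μ t ≤ Real.exp (t ^ 2 * σ ^ 2) := fun k => by
    have h1 : mgf (Z k) μ t = p.expect fun s => Real.exp (t * (f s - p.expect f)) := by
      rw [← PMF.integral_toMeasure, ← hlaw k, integral_map (hm k).aemeasurable]
      · rfl
      · exact Measurable.aestronglyMeasurable Measurable.of_discrete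
    rw [h1, hσ]
    exact p.expect_exp_le hB ht0 htB
  have hint : Integrable (fun ω => Real.exp (t * (∑ k, Z k) ω)) μ := by
    refine Integrable.of_bound (C := Real.exp (t * (N * B))) ?_ (ae_of_all _ fun ω => ?_)
    · simp only [Finset.sum_apply]
      exact (((Finset.measurable_sum _ fun k _ => hZm k).const_mul t).exp).aestronglyMeasurable
    · rw [Real.norm_eq_abs, Real.abs_exp, Real.exp_le_exp, Finset.sum_apply]
      refine mul_le_mul_of_nonneg_left ?_ ht0
      refine (Finset.sum_le_sum fun k _ => (le_abs_self _).trans (hB (Y k ω))).trans ?_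
      simp
  have hch := measure_ge_le_exp_mul_mgf (X := ∑ k, Z k) (μ := μ) (N * r) ht0 hint
  rw [hZind.mgf_sum hZm] at hch
  have hset : {ω | r ≤ (∑ k, f (Y k ω)) / N - p.expect f} = {ω | N * r ≤ (∑ k, Z k) ω} := by
    ext ω
    simp only [Set.mem_ofPred_eq, Finset.sum_apply, Z, Finset.sum_sub_distrib, Finset.sum_const,
      Finset.card_univ, Fintype.card_fin, nsmul_eq_mul]
    rw [le_sub_iff_add_le, le_div_iff₀ hN', le_sub_iff_add_le]
    constructor <;> intro h <;> linarith
  rw [hset]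
  refine hch.trans ?_
  calc Real.exp (-t * (N * r)) * ∏ k, mgf (Z k) μ t
      ≤ Real.exp (-t * (N * r)) * ∏ _k : Fin N, Real.exp (t ^ 2 * σ ^ 2) := by
        gcongr with k
        · exact fun k _ => mgf_nonneg
        · exact hmgf k
    _ = Real.exp (N * (t ^ 2 * σ ^ 2 - t * r)) := by
        rw [Finset.prod_const, Finset.card_univ, Fintype.card_fin, ← Real.exp_nat_mul,
          ← Real.exp_add]
        congr 1
        ring
    _ ≤ Real.exp (-(N * q ^ 2)) := by
        rw [Real.exp_le_exp, ← mul_neg]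
        exact mul_le_mul_of_nonneg_left (by linarith) hN'.le

/-- Bernstein's inequality for an empirical mean. -/
lemma measureReal_bernstein_abs_le (hN : 0 < N) {Y : Fin N → Ω → S} {p : PMF S}
    (hm : ∀ k, Measurable (Y k)) (hlaw : ∀ k, μ.map (Y k) = p.toMeasure) (hind : iIndepFun Y μ)
    {f : S → ℝ} {B q : ℝ} (hB : ∀ s, f s ∈ Set.Icc 0 B) (hB0 : 0 < B) (hq : 0 < q) :
    μ.real {ω | 2 * √(p.var f) * q + B * q ^ 2 ≤ |(∑ k, f (Y k ω)) / N - p.expect f|} ≤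
      2 * Real.exp (-(N * q ^ 2)) := by
  have h0 : 0 ≤ p.expect f := p.le_expect fun s => (hB s).1
  have h1 : p.expect f ≤ B := p.expect_le fun s => (hB s).2
  have hn : p.expect (fun s => -f s) = -p.expect f := by simp [PMF.expect]
  have hu := measureReal_bernstein_le hN hm hlaw hind (f := f) (B := B)
    (fun s => abs_le.2 ⟨by linarith [(hB s).1], by linarith [(hB s).2]⟩) hB0 hq
  have hl := measureReal_bernstein_le hN hm hlaw hind (f := fun s => -f s) (B := B)
    (fun s => by
      rw [hn]
      exact abs_le.2 ⟨by linarith [(hB s).2], by linarith [(hB s).1]⟩) hB0 hq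
  rw [PMF.var_neg, hn] at hl
  rw [two_mul (Real.exp _)]
  refine (measureReal_mono ?_).trans ((measureReal_union_le _ _).trans (add_le_add hu hl))
  intro ω hω
  rcases le_abs.1 hω.out with h | h
  · exact Or.inl h
  · refine Or.inr (h.trans_eq ?_)
    rw [Finset.sum_neg_distrib]
    ring

end Bernstein

section Empirical

lemma expect_empiricalPMF {S : Type*} [Fintype S] [DecidableEq S] {N : ℕ} [NeZero N]
    (x : Fin N → S) (f : S → ℝ) : (empiricalPMF x).expect f = (∑ k, f (x k)) / N := by
  have h : ∀ s, (empiricalPMF x s).toReal * f s =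
      (∑ k, if x k = s then f (x k) else 0) / N := fun s => by
    have h1 : ∑ k, (if x k = s then f (x k) else 0) =
        (Finset.univ.filter fun k => x k = s).card * f s := by
      rw [← Finset.sum_filter, Finset.sum_congr rfl (g := fun _ => f s), Finset.sum_const,
        nsmul_eq_mul]
      intro k hk
      rw [(Finset.mem_filter.1 hk).2]
    rw [h1, empiricalPMF, PMF.ofFintype_apply, ENNReal.toReal_div, ENNReal.toReal_natCast,
      ENNReal.toReal_natCast]
    ring
  simp only [PMF.expect, h]
  rw [← Finset.sum_div, Finset.sum_comm]
  simp

end Empirical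

/-! ### Concentration for sample-dependent functions -/

section Concentration

variable {S A Ω : Type*} [Fintype S] [DecidableEq S] [MeasurableSpace S]
  [DiscreteMeasurableSpace S] [Fintype A] [MeasurableSpace Ω]
  {μ : Measure Ω} [IsProbabilityMeasure μ] {N : ℕ} [NeZero N] {M : MDP S A}
  {X : S → A → Fin N → Ω → S}

/-- Bernstein's inequality for a function that depends on the samples at the other states only. -/
lemma IsGenerativeSample.measureReal_bernstein_le (hX : IsGenerativeSample M X μ)
    {s : S} {W : (S → A → Fin N → S) → S → ℝ} {B q : ℝ}
    (hdep : ∀ x x', (∀ y ≠ s, x y = x' y) → W x = W x')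
    (hB : ∀ x y, W x y ∈ Set.Icc 0 B) (hB0 : 0 < B) (hq : 0 < q) (a : A) :
    μ.real {ω | 2 * √((M.P s a).var (W fun s a k => X s a k ω)) * q + B * q ^ 2 ≤
      |(empiricalPMF fun k => X s a k ω).expect (W fun s a k => X s a k ω) -
        (M.P s a).expect (W fun s a k => X s a k ω)|} ≤ 2 * Real.exp (-(N * q ^ 2)) := by
  classical
  let I : Finset (S × A × Fin N) := Finset.univ.filter fun i => i.1 = s
  let J : Finset (S × A × Fin N) := Finset.univ.filter fun i => i.1 ≠ s
  have hIJ : Disjoint I J := Finset.disjoint_filter_filter_not _ _ _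
  have hind := hX.indep.indepFun_finset I J hIJ fun i => hX.measurable _ _ _
  set ξ : Ω → I → S := fun ω i => X i.1.1 i.1.2.1 i.1.2.2 ω
  set ζ : Ω → J → S := fun ω i => X i.1.1 i.1.2.1 i.1.2.2 ω
  have hζm : Measurable ζ := measurable_pi_lambda _ fun i => hX.measurable _ _ _
  -- `W'` rebuilds W from the samples at the other states; the filler `s` in the missing entries is
  -- irrelevant by `hdep`. On each event {ζ = w} the function is then fixed, and independence from
  -- the samples at `s` allows the fixed-function Bernstein bound.
  let W' : (J → S) → S → ℝ := fun w => W fun y b k =>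
    if h : (y, b, k) ∈ J then w ⟨(y, b, k), h⟩ else s
  have hW : ∀ ω, W (fun s a k => X s a k ω) = W' (ζ ω) := fun ω => hdep _ _ fun y hy => by
    funext b k
    simp [J, hy, ζ]
  let T : (J → S) → Set (I → S) := fun w => {u | 2 * √((M.P s a).var (W' w)) * q + B * q ^ 2 ≤
    |(∑ k, W' w (u ⟨(s, a, k), by simp [I]⟩)) / N - (M.P s a).expect (W' w)|}
  have hT : ∀ w, μ.real (ξ ⁻¹' T w) ≤ 2 * Real.exp (-(N * q ^ 2)) := fun w =>
    measureReal_bernstein_abs_le (NeZero.pos N) (fun k => hX.measurable s a k)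
      (fun k => hX.law s a k)
      (hX.indep.precomp (g := fun k : Fin N => (s, a, k)) fun k l h => by simpa using h)
      (hB _) hB0 hq
  have hmeas : ∀ w, MeasurableSet (ζ ⁻¹' {w}) := fun w => hζm (measurableSet_singleton w)
  calc _ ≤ μ.real (⋃ w ∈ (Finset.univ : Finset (J → S)), ξ ⁻¹' T w ∩ ζ ⁻¹' {w}) := by
        refine measureReal_mono (fun ω hω => ?_) (measure_ne_top _ _)
        simp only [Set.mem_iUnion]
        refine ⟨ζ ω, Finset.mem_univ _, ?_, rfl⟩
        have h := hω.out
        rwa [hW, expect_empiricalPMF] at h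
    _ ≤ ∑ w, μ.real (ξ ⁻¹' T w ∩ ζ ⁻¹' {w}) := measureReal_biUnion_finset_le _ _
    _ = ∑ w, μ.real (ξ ⁻¹' T w) * μ.real (ζ ⁻¹' {w}) := by
        refine Finset.sum_congr rfl fun w _ => ?_
        rw [measureReal_def, hind.measure_inter_preimage_eq_mul _ _ (Set.toFinite _).measurableSet
          (measurableSet_singleton w), ENNReal.toReal_mul]
        rfl
    _ ≤ ∑ w, 2 * Real.exp (-(N * q ^ 2)) * μ.real (ζ ⁻¹' {w}) :=
        Finset.sum_le_sum fun w _ => mul_le_mul_of_nonneg_right (hT w) measureReal_nonneg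
    _ = 2 * Real.exp (-(N * q ^ 2)) := by
        rw [← Finset.mul_sum, sum_measureReal_preimage_singleton _ fun w _ => hmeas w]
        simp

/-- Simultaneous Bernstein inequalities, at every state-action pair, for finitely many functions
each of which depends on the samples at the other states only. -/
lemma IsGenerativeSample.exists_measurableSet_bernstein (hX : IsGenerativeSample M X μ)
    {J : Type*} [Fintype J] {W : J → S → (S → A → Fin N → S) → S → ℝ} {B : J → ℝ} {q : ℝ}
    (hdep : ∀ j s x x', (∀ y ≠ s, x y = x' y) → W j s x = W j s x')
    (hB : ∀ j s x y, W j s x y ∈ Set.Icc 0 (B j)) (hB0 : ∀ j, 0 < B j) (hq : 0 < q) :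
    ∃ E : Set Ω, MeasurableSet E ∧
      1 - Fintype.card S * Fintype.card A * Fintype.card J * (2 * Real.exp (-(N * q ^ 2))) ≤
        μ.real E ∧
      ∀ ω ∈ E, ∀ j s a,
        |(empiricalPMF fun k => X s a k ω).expect (W j s fun s a k => X s a k ω) -
          (M.P s a).expect (W j s fun s a k => X s a k ω)| ≤
        2 * √((M.P s a).var (W j s fun s a k => X s a k ω)) * q + B j * q ^ 2 := by
  classical
  let D : S × A × J → Set (S → A → Fin N → S) := fun i =>
    {x | 2 * √((M.P i.1 i.2.1).var (W i.2.2 i.1 x)) * q + B i.2.2 * q ^ 2 ≤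
      |(empiricalPMF (x i.1 i.2.1)).expect (W i.2.2 i.1 x) -
        (M.P i.1 i.2.1).expect (W i.2.2 i.1 x)|}
  let ξ : Ω → S → A → Fin N → S := fun ω s a k => X s a k ω
  have hξ : Measurable ξ := measurable_pi_lambda _ fun s => measurable_pi_lambda _ fun a =>
    measurable_pi_lambda _ fun k => hX.measurable s a k
  have hD : MeasurableSet (⋃ i ∈ (Finset.univ : Finset (S × A × J)), ξ ⁻¹' D i) :=
    Finset.measurableSet_biUnion _ fun i _ => hξ (Set.toFinite _).measurableSet
  refine ⟨_, hD.compl, ?_, ?_⟩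
  · rw [probReal_compl_eq_one_sub hD]
    refine sub_le_sub_left ((measureReal_biUnion_finset_le _ _).trans
      ((Finset.sum_le_sum fun i _ => hX.measureReal_bernstein_le (hdep i.2.2 i.1)
        (hB i.2.2 i.1) (hB0 i.2.2) hq i.2.1).trans_eq ?_)) 1
    rw [Finset.sum_const, Finset.card_univ, nsmul_eq_mul, Fintype.card_prod, Fintype.card_prod]
    push_cast
    ring
  · intro ω hω j s a
    by_contra hcon
    refine hω ?_
    simp only [Set.mem_iUnion]
    exact ⟨(s, a, j), Finset.mem_univ _, (not_le.1 hcon).le⟩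

end Concentration

/-! ### Total variance and perturbation of the kernel -/

namespace MDP

variable {S A : Type*} [Fintype S] [Fintype A]
  [MeasurableSpace S] [DiscreteMeasurableSpace S]
  [MeasurableSpace A] [DiscreteMeasurableSpace A]

/-- The expected discounted sum of the one-step variances of `M.V π` along the policy `π` is at
most `5 / (4 (1 - γ) ^ 2)`; `f` is a certificate of this bound. -/
structure IsVarianceCertificate (M : MDP S A) (π : S → PMF A) (f : S → ℝ) : Prop where
  mem_Icc : ∀ s, f s ∈ Set.Icc 0 (5 / 4 * (1 / (1 - M.γ)) ^ 2)
  expect_le : ∀ s, (π s).expect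
    (fun a => (M.P s a).var (M.V π) + M.γ * (M.P s a).expect f) ≤ f s

/-- With H = 1/(1-γ), the function 2HV - V² is at most H², and division by γ costs at most 5/4 when
γ ≥ 4/5. Otherwise H ≤ 5, and the crude variance bound H²/4 over the horizon gives H³/4 ≤ (5/4)H².
-/
lemma exists_isVarianceCertificate {M : MDP S A} (hγ0 : 0 ≤ M.γ) (hγ1 : M.γ < 1)
    (hR : ∀ s a, M.R s a ∈ Set.Icc (0 : ℝ) 1) (π : S → PMF A) :
    ∃ f, M.IsVarianceCertificate π f := by
  set H := 1 / (1 - M.γ) with hH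
  have h1 : 0 < 1 - M.γ := by linarith
  have hH0 : 0 < H := by positivity
  have hHγ : H * (1 - M.γ) = 1 := by rw [hH]; field_simp
  have hV : ∀ s, M.V π s ∈ Set.Icc 0 H := V_mem_Icc hγ0 hγ1 hR π
  rcases le_or_gt (4 / 5) M.γ with hγ | hγ
  · have hγp : 0 < M.γ := by linarith
    refine ⟨fun s => (2 * H * M.V π s - M.V π s ^ 2) / M.γ, fun s => ⟨?_, ?_⟩, fun s => ?_⟩
    · refine div_nonneg ?_ hγ0
      nlinarith [(hV s).1, (hV s).2]
    · rw [div_le_iff₀ hγp]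
      nlinarith [sq_nonneg (H - M.V π s), sq_nonneg H]
    · have hf : ∀ p : PMF S, M.γ * p.expect (fun s => (2 * H * M.V π s - M.V π s ^ 2) / M.γ) =
          2 * H * p.expect (M.V π) - p.expect fun s => M.V π s ^ 2 := fun p => by
        rw [← PMF.expect_const_mul, ← PMF.expect_const_mul, ← PMF.expect_sub]
        congr 1
        funext s
        field_simp
      have hQ : ∀ a, M.γ * ((M.P s a).var (M.V π) +
          M.γ * (M.P s a).expect (fun s => (2 * H * M.V π s - M.V π s ^ 2) / M.γ)) ≤
          2 * H * M.lookahead (M.V π) s a - M.lookahead (M.V π) s a ^ 2 := fun a => by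
        rw [hf, PMF.var_eq]
        have hp1 : (M.P s a).expect (M.V π) ≤ H := PMF.expect_le _ fun x => (hV x).2
        have hr := hR s a
        unfold lookahead
        set e := (M.P s a).expect (M.V π)
        set r := M.R s a
        have hq : r + M.γ * e ≤ H := by
          have := mul_le_mul_of_nonneg_left hp1 hγ0
          linarith [hr.2]
        -- The right side minus the left side equals 2r(H - (r + γe)) + r² + γ(1-γ)e².
        have e1 : 0 ≤ 2 * r * (H - (r + M.γ * e)) :=
          mul_nonneg (mul_nonneg two_pos.le hr.1) (sub_nonneg.2 hq)
        have e2 : 0 ≤ M.γ * (1 - M.γ) * e ^ 2 := by positivity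
        nlinarith [sq_nonneg r]
      have h2 := (π s).expect_mono hQ
      rw [PMF.expect_const_mul, PMF.expect_sub, PMF.expect_const_mul,
        ← M.V_eq_expect hγ0 hγ1] at h2
      -- Jensen's inequality over the actions, as the bound is concave in the lookahead value.
      have h3 := (π s).sq_expect_le fun a => M.lookahead (M.V π) s a
      rw [← M.V_eq_expect hγ0 hγ1] at h3
      rw [le_div_iff₀ hγp]
      linarith
  · refine ⟨fun _ => H ^ 3 / 4, fun s => ⟨by positivity, ?_⟩, fun s => ?_⟩
    · have : H ≤ 5 := by nlinarith
      nlinarith [sq_nonneg H]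
    · refine PMF.expect_le _ fun a => ?_
      have h2 := (M.P s a).var_le_of_mem_Icc hV
      rw [PMF.expect_const]
      have h3 : H ^ 3 / 4 - M.γ * (H ^ 3 / 4) = H ^ 2 / 4 * (H * (1 - M.γ)) := by ring
      rw [hHγ] at h3
      linarith

/-- Comparison principle for the Bellman equation of a policy with one-step rewards `d`. -/
lemma le_of_policy_supersolution {S A : Type*} [Fintype S] [Fintype A] {M : MDP S A}
    (hγ0 : 0 ≤ M.γ) (hγ1 : M.γ < 1) {π : S → PMF A} {u z : S → ℝ} {d : S → A → ℝ}
    (hu : ∀ s, u s ≤ (π s).expect fun a => d s a + M.γ * (M.P s a).expect u)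
    (hz : ∀ s, (π s).expect (fun a => d s a + M.γ * (M.P s a).expect z) ≤ z s) (s : S) :
    u s ≤ z s := by
  have h := le_div_one_sub_of_forall_le (u := fun s => u s - z s) (c := 0) hγ1
    (fun b hb s => ?_) s
  · simpa using h
  · have h1 : (π s).expect (fun a => (d s a + M.γ * (M.P s a).expect u) -
        (d s a + M.γ * (M.P s a).expect z)) ≤ M.γ * b := PMF.expect_le _ fun a => by
      have := mul_le_mul_of_nonneg_left ((M.P s a).expect_le hb) hγ0
      rw [PMF.expect_sub] at this
      linarith
    rw [PMF.expect_sub] at h1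
    linarith [hu s, hz s]

section Perturbation

variable {M M' : MDP S A} (hγ0 : 0 ≤ M.γ) (hγ1 : M.γ < 1) (hR' : M'.R = M.R) (hγ' : M'.γ = M.γ)
include hγ0 hγ1 hR' hγ'

/-- Simulation lemma: change of the value of a policy under a perturbation of the kernel. -/
lemma abs_V_sub_V_le (hR : ∀ s a, M.R s a ∈ Set.Icc (0 : ℝ) 1) {π : S → PMF A} {h q κ : ℝ}
    (hh : 0 < h) (hh2 : h ^ 2 = 1 / (1 - M.γ)) (hq : 0 ≤ q)
    (hP : ∀ s a, |(M'.P s a).expect (M'.V π) - (M.P s a).expect (M'.V π)| ≤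
      q * ((M.P s a).var (M.V π) / h + h) + κ) (s : S) :
    |M'.V π s - M.V π s| ≤ M.γ * (5 / 4 * q * h ^ 3 + h ^ 2 * (q * h + κ)) := by
  obtain ⟨f, hf⟩ := exists_isVarianceCertificate hγ0 hγ1 hR π
  have h1 : 0 < 1 - M.γ := by linarith
  have hHγ : h ^ 2 * (1 - M.γ) = 1 := by rw [hh2]; field_simp
  -- Supersolution for the accumulated error: the variance term is paid by f, the constant term by
  -- the horizon h² = 1/(1-γ).
  let z : S → ℝ := fun s => M.γ * (q / h * f s + h ^ 2 * (q * h + κ))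
  have hzP : ∀ p : PMF S, p.expect z = M.γ * (q / h * p.expect f + h ^ 2 * (q * h + κ)) :=
    fun p => by
      simp only [z]
      rw [PMF.expect_const_mul, PMF.expect_add, PMF.expect_const_mul, PMF.expect_const]
  have hz : ∀ d : S → A → ℝ, (∀ s a, d s a ≤ M.γ * (q * ((M.P s a).var (M.V π) / h + h) + κ)) →
      ∀ s, (π s).expect (fun a => d s a + M.γ * (M.P s a).expect z) ≤ z s := by
    intro d hd s
    have h2 : (π s).expect (fun a => d s a + M.γ * (M.P s a).expect z) ≤
        (π s).expect fun a => M.γ * (q / h) *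
          ((M.P s a).var (M.V π) + M.γ * (M.P s a).expect f) +
          M.γ * h ^ 2 * (q * h + κ) := by
      refine PMF.expect_mono _ fun a => ?_
      rw [hzP]
      have h3 : M.γ * (q * ((M.P s a).var (M.V π) / h + h) + κ) =
        M.γ * (q / h) * (M.P s a).var (M.V π) +
          M.γ * (q * h + κ) * (h ^ 2 * (1 - M.γ)) := by
        rw [hHγ]; ring
      linarith [hd s a]
    refine h2.trans ?_
    rw [PMF.expect_add, PMF.expect_const_mul, PMF.expect_const]
    have h4 : M.γ * (q / h) * (π s).expect (fun a => (M.P s a).var (M.V π) +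
        M.γ * (M.P s a).expect f) ≤ M.γ * (q / h) * f s :=
      mul_le_mul_of_nonneg_left (hf.expect_le s) (by positivity)
    simp only [z]
    linarith
  have hzle : ∀ s, z s ≤ M.γ * (5 / 4 * q * h ^ 3 + h ^ 2 * (q * h + κ)) := fun s => by
    refine mul_le_mul_of_nonneg_left ?_ hγ0
    have h2 : q / h * f s ≤ q / h * (5 / 4 * (h ^ 2) ^ 2) := by
      rw [hh2]
      exact mul_le_mul_of_nonneg_left (hf.mem_Icc s).2 (by positivity)
    have h3 : q / h * (5 / 4 * (h ^ 2) ^ 2) = 5 / 4 * q * h ^ 3 := by field_simp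
    linarith
  -- The kernel error acts on the value in `M'` but is propagated by `M`, so a certificate for `M`
  -- suffices.
  have hu : ∀ s, M'.V π s - M.V π s = (π s).expect fun a =>
      M.γ * ((M'.P s a).expect (M'.V π) - (M.P s a).expect (M'.V π)) +
      M.γ * (M.P s a).expect fun x => M'.V π x - M.V π x := fun s => by
    rw [M.V_eq_expect hγ0 hγ1 π s, M'.V_eq_expect (by rw [hγ']; exact hγ0)
      (by rw [hγ']; exact hγ1) π s, ← PMF.expect_sub]
    congr 1
    funext a
    rw [PMF.expect_sub, lookahead, lookahead, hR', hγ']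
    ring
  rw [abs_le']
  constructor
  · refine (le_of_policy_supersolution hγ0 hγ1 (fun s => (hu s).le)
      (hz _ fun s a => ?_) s).trans (hzle s)
    exact mul_le_mul_of_nonneg_left ((le_abs_self _).trans (hP s a)) hγ0
  · refine (le_of_policy_supersolution (u := fun s => -(M'.V π s - M.V π s))
      (d := fun s a => -(M.γ * ((M'.P s a).expect (M'.V π) - (M.P s a).expect (M'.V π))))
      hγ0 hγ1 (fun s => ?_) (hz _ fun s a => ?_) s).trans (hzle s)
    · refine le_of_eq ?_
      have h5 : ∀ p : PMF A, ∀ f : A → ℝ, -p.expect f = p.expect fun a => -f a := fun p f => by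
        simp [PMF.expect]
      have h6 : ∀ p : PMF S, ∀ f : S → ℝ, -p.expect f = p.expect fun a => -f a := fun p f => by
        simp [PMF.expect]
      rw [hu, h5]
      congr 1
      funext a
      rw [← h6]
      ring
    · rw [← mul_neg]
      exact mul_le_mul_of_nonneg_left ((neg_le_abs _).trans (hP s a)) hγ0

lemma abs_optV_sub_optV_le [Nonempty A] {β : ℝ}
    (hβ : ∀ s a, |(M'.P s a).expect M.optV - (M.P s a).expect M.optV| ≤ β) (s : S) :
    |M.optV s - M'.optV s| ≤ M.γ * β / (1 - M.γ) := by
  have hγ0' : 0 ≤ M'.γ := by rwa [hγ']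
  have hγ1' : M'.γ < 1 := by rwa [hγ']
  have h1 : M.IsOptimalValue M.optV := isOptimalValue_optV hγ0 hγ1
  have h2 : M'.IsOptimalValue M'.optV := isOptimalValue_optV hγ0' hγ1'
  have hd : ∀ s a, |M'.lookahead M.optV s a - M.lookahead M.optV s a| ≤ M.γ * β := fun s a => by
    have : M'.lookahead M.optV s a - M.lookahead M.optV s a =
        M.γ * ((M'.P s a).expect M.optV - (M.P s a).expect M.optV) := by
      rw [lookahead, lookahead, hR', hγ']
      ring
    rw [this, abs_mul, abs_of_nonneg hγ0]
    exact mul_le_mul_of_nonneg_left (hβ s a) hγ0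
  refine abs_sub_le_iff.2 ⟨?_, ?_⟩
  · refine le_div_one_sub_of_forall_le (u := fun s => M.optV s - M'.optV s) hγ1
      (fun b hb s => ?_) s
    obtain ⟨a, ha⟩ := h1.exists_eq s
    have h3 := M'.lookahead_le_add hγ0' hb s a
    have h4 := (abs_le.1 (hd s a)).1
    have h5 := h2.lookahead_le s a
    rw [hγ'] at h3
    linarith
  · refine le_div_one_sub_of_forall_le (u := fun s => M'.optV s - M.optV s) hγ1
      (fun b hb s => ?_) s
    obtain ⟨a, ha⟩ := h2.exists_eq s
    have h3 := M'.lookahead_le_add hγ0' hb s a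
    have h4 := (abs_le.1 (hd s a)).2
    have h5 := h1.lookahead_le s a
    rw [hγ'] at h3
    linarith

/-- Subtracting z from the optimal value of `M` gives a subsolution for the fixed policy π in `M'`.
Only fixed functions meet the kernel error, at the price of controlling f under `M'.P` as well,
through φ. -/
lemma optV_sub_optV_le [Nonempty A] {π : S → PMF A} {f : S → ℝ} {h q κ φ : ℝ}
    (hπ : M.V π = M.optV) (hf : M.IsVarianceCertificate π f)
    (hh : 0 < h) (hh2 : h ^ 2 = 1 / (1 - M.γ)) (hq : 0 ≤ q)
    (hP : ∀ s a, |(M'.P s a).expect M.optV - (M.P s a).expect M.optV| ≤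
      q * ((M.P s a).var M.optV / h + h) + κ)
    (hφ0 : 0 ≤ φ) (hφ : ∀ s a, |(M'.P s a).expect f - (M.P s a).expect f| ≤ φ) (s : S) :
    M.optV s - M'.optV s ≤
      M.γ * (5 / 4 * q * h ^ 3 + h ^ 2 * (q * h + κ + q / h * φ)) := by
  have hγ0' : 0 ≤ M'.γ := by rwa [hγ']
  have hγ1' : M'.γ < 1 := by rwa [hγ']
  have h1 : 0 < 1 - M.γ := by linarith
  have hHγ : h ^ 2 * (1 - M.γ) = 1 := by rw [hh2]; field_simp
  let C := h ^ 2 * (q * h + κ + q / h * φ)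
  let z : S → ℝ := fun s => M.γ * (q / h * f s + C)
  have hzP : ∀ p : PMF S, p.expect z = M.γ * (q / h * p.expect f + C) :=
    fun p => by
      simp only [z]
      rw [PMF.expect_const_mul, PMF.expect_add, PMF.expect_const_mul, PMF.expect_const]
  have hle : ∀ s, M.optV s - z s ≤ M'.optV s := by
    refine le_of_lookahead_le (π := π) hγ0' hγ1' (fun s => ?_)
      (isOptimalValue_optV hγ0' hγ1').lookahead_le
    have h2 : (π s).expect (fun a => M.lookahead M.optV s a - (M.γ * (q / h) *
        ((M.P s a).var M.optV + M.γ * (M.P s a).expect f) + M.γ * C)) ≤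
        (π s).expect fun a => M'.lookahead (fun s => M.optV s - z s) s a := by
      refine PMF.expect_mono _ fun a => ?_
      simp only [lookahead]
      rw [PMF.expect_sub, hzP, hR', hγ']
      have h3 := mul_le_mul_of_nonneg_left (abs_le.1 (hP s a)).1 hγ0
      have h4 : M.γ * ((q / h) * (M.γ * ((M'.P s a).expect f - (M.P s a).expect f))) ≤
          M.γ * ((q / h) * φ) := by
        have h5 : M.γ * ((M'.P s a).expect f - (M.P s a).expect f) ≤ φ := by
          have := mul_le_mul_of_nonneg_left (abs_le.1 (hφ s a)).2 hγ0
          nlinarith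
        exact mul_le_mul_of_nonneg_left (mul_le_mul_of_nonneg_left h5 (by positivity)) hγ0
      have h6 : C * (1 - M.γ) = q * h + κ + q / h * φ := by
        simp only [C]
        linear_combination (q * h + κ + q / h * φ) * hHγ
      have h7 : M.γ * C - M.γ * (M.γ * C) = M.γ * (q * h + κ + q / h * φ) := by
        rw [← h6]; ring
      have h8 : M.γ * (q * ((M.P s a).var M.optV / h + h) + κ) =
        M.γ * (q / h) * (M.P s a).var M.optV + M.γ * (q * h + κ) := by ring
      linarith
    refine le_trans ?_ h2
    rw [PMF.expect_sub, PMF.expect_add, PMF.expect_const_mul, PMF.expect_const]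
    have h9 := hf.expect_le s
    have h10 := M.V_eq_expect hγ0 hγ1 π s
    rw [hπ] at h9 h10
    rw [← h10]
    have h11 := mul_le_mul_of_nonneg_left h9 (show 0 ≤ M.γ * (q / h) by positivity)
    simp only [z]
    linarith
  have h2 : q / h * f s ≤ q / h * (5 / 4 * (h ^ 2) ^ 2) := by
    rw [hh2]
    exact mul_le_mul_of_nonneg_left (hf.mem_Icc s).2 (by positivity)
  have h3 : q / h * (5 / 4 * (h ^ 2) ^ 2) = 5 / 4 * q * h ^ 3 := by field_simp
  have h4 : z s ≤ M.γ * (5 / 4 * q * h ^ 3 + C) :=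
    mul_le_mul_of_nonneg_left (by linarith) hγ0
  linarith [hle s]

end Perturbation

end MDP

/-! ### Planning error under Bernstein-type bounds -/

namespace MDP

variable {S A : Type*} [Fintype S] [Fintype A]
  [MeasurableSpace S] [DiscreteMeasurableSpace S]
  [MeasurableSpace A] [DiscreteMeasurableSpace A]

lemma two_mul_sqrt_mul_le {v h q : ℝ} (hv : 0 ≤ v) (hh : 0 < h) (hq : 0 ≤ q) :
    2 * √v * q ≤ q * (v / h + h) := by
  have h1 : 2 * √v ≤ v / h + h := by
    have h2 : v / h + h - 2 * √v = (√v - h) ^ 2 / h := by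
      rw [sub_sq, Real.sq_sqrt hv]
      field_simp
      ring
    have : 0 ≤ (√v - h) ^ 2 / h := by positivity
    linarith
  nlinarith

/-- Error of planning in a perturbed model `M'`, when the perturbation satisfies Bernstein-type
bounds for the optimal value of `M`, for a variance certificate and, up to `2 q`, for the optimal
value of `M'`. -/
lemma optV_sub_V_le_of_bernstein [Nonempty A] {M M' : MDP S A} (hγ0 : 0 ≤ M.γ) (hγ1 : M.γ < 1)
    (hR' : M'.R = M.R) (hγ' : M'.γ = M.γ) (hR : ∀ s a, M.R s a ∈ Set.Icc (0 : ℝ) 1)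
    {π π' : S → PMF A} {f : S → ℝ} {h q ε : ℝ}
    (hπ : M.V π = M.optV) (hf : M.IsVarianceCertificate π f)
    (hh : 0 < h) (hh2 : h ^ 2 = 1 / (1 - M.γ)) (hq : 0 ≤ q) (hqh : q * h ^ 2 ≤ 1 / 18)
    (hV : ∀ s a, |(M'.P s a).expect M.optV - (M.P s a).expect M.optV| ≤
      2 * √((M.P s a).var M.optV) * q + h ^ 2 * q ^ 2)
    (hfP : ∀ s a, |(M'.P s a).expect f - (M.P s a).expect f| ≤
      2 * √((M.P s a).var f) * q + 5 / 4 * (h ^ 2) ^ 2 * q ^ 2)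
    (hW : ∀ s a, ∃ W : S → ℝ, (∀ x, |M'.optV x - W x| ≤ 2 * q) ∧
      |(M'.P s a).expect W - (M.P s a).expect W| ≤
        2 * √((M.P s a).var W) * q + h ^ 2 * q ^ 2)
    (hε : ∀ s, M'.optV s - M'.V π' s ≤ ε) (s : S) :
    M.optV s - M.V π' s ≤ 14 * M.γ * (q * h ^ 3) + 4 * h ^ 2 * ε := by
  have hγ0' : 0 ≤ M'.γ := by rwa [hγ']
  have hγ1' : M'.γ < 1 := by rwa [hγ']
  have h1 : 0 < 1 - M.γ := by linarith
  have hh21 : 1 ≤ h ^ 2 := by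
    rw [hh2, le_div_iff₀ h1]
    linarith
  have hh1 : 1 ≤ h := by nlinarith
  have hε0 : 0 ≤ ε := by linarith [hε s, V_le_optV hγ0' hγ1' π' s]
  have hε' : ∀ x, |M'.optV x - M'.V π' x| ≤ ε := fun x => by
    rw [abs_of_nonneg (sub_nonneg.2 (V_le_optV hγ0' hγ1' π' x))]
    exact hε x
  set Y := q * h ^ 3 with hY
  have hq18 : q ≤ 1 / 18 := (le_mul_of_one_le_right hq hh21).trans hqh
  have hY2 : q * h ^ 2 ≤ Y := by
    have : q * h ^ 2 * 1 ≤ q * h ^ 2 * h := mul_le_mul_of_nonneg_left hh1 (by positivity)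
    rw [hY]; linarith
  have hY1 : q ≤ Y := by
    have : q * 1 ≤ q * h ^ 2 := mul_le_mul_of_nonneg_left hh21 hq
    linarith
  have hY4 : h ^ 2 * (h ^ 2 * q ^ 2) ≤ Y / 18 := by
    have := mul_le_mul_of_nonneg_left hqh (show 0 ≤ q * h ^ 2 by positivity)
    linarith
  have hY0 : 0 ≤ Y := by positivity
  -- the gap between the two optimal values
  have hT1 : M.optV s - M'.optV s ≤ M.γ * (3 * Y) := by
    -- The standard deviation of f is at most half of its range 5/4 h⁴.
    let φ := 5 / 4 * h ^ 4 * (q + q ^ 2)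
    have hφ : ∀ s a, |(M'.P s a).expect f - (M.P s a).expect f| ≤ φ := fun s a => by
      refine (hfP s a).trans ?_
      have h2 : √((M.P s a).var f) ≤ 5 / 4 * (h ^ 2) ^ 2 / 2 := by
        refine (Real.sqrt_le_left (by positivity)).2 ?_
        refine ((M.P s a).var_le_of_mem_Icc hf.mem_Icc).trans_eq ?_
        rw [hh2]
        ring
      have := mul_le_mul_of_nonneg_right h2 hq
      simp only [φ]
      linarith
    refine (optV_sub_optV_le hγ0 hγ1 hR' hγ' hπ hf hh hh2 hq (κ := h ^ 2 * q ^ 2)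
      (fun s a => (hV s a).trans ?_) (φ := φ) (by positivity) hφ s).trans
      (mul_le_mul_of_nonneg_left ?_ hγ0)
    · linarith [two_mul_sqrt_mul_le ((M.P s a).var_nonneg M.optV) hh hq]
    · have h3 : h ^ 2 * (q / h * φ) = 5 / 4 * (Y * (q * h ^ 2) * (1 + q)) := by
        simp only [φ, hY]
        field_simp
      have h4 : Y * (q * h ^ 2) * (1 + q) ≤ Y * (1 / 18) * (1 + 1 / 18) := by gcongr
      nlinarith
  -- the gap between the two values of `π'`
  have : Nonempty S := ⟨s⟩
  obtain ⟨t, ht⟩ := Finite.exists_max fun x => |M'.V π' x - M.V π' x|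
  set D := |M'.V π' t - M.V π' t| with hD
  have hT2 : D ≤ M.γ * (5 / 4 * q * h ^ 3 + h ^ 2 * (q * h +
      (2 * q * (2 * q + ε + D) + h ^ 2 * q ^ 2 + 2 * (2 * q + ε)))) := by
    refine abs_V_sub_V_le hγ0 hγ1 hR' hγ' hR hh hh2 hq (fun s a => ?_) t
    obtain ⟨W, hW1, hW2⟩ := hW s a
    have e1 : ∀ x, |M'.V π' x - W x| ≤ 2 * q + ε := fun x => by
      have := abs_sub_le (M'.V π' x) (M'.optV x) (W x)
      rw [abs_sub_comm (M'.V π' x) (M'.optV x)] at this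
      linarith [hW1 x, hε' x]
    have e2 : ∀ x, |W x - M.V π' x| ≤ 2 * q + ε + D := fun x => by
      have := abs_sub_le (W x) (M'.V π' x) (M.V π' x)
      rw [abs_sub_comm (W x) (M'.V π' x)] at this
      linarith [e1 x, ht x]
    have e3 : ∀ p : PMF S, |p.expect (M'.V π') - p.expect W| ≤ 2 * q + ε := fun p => by
      rw [← PMF.expect_sub]
      exact p.abs_expect_le e1
    have e4 := mul_le_mul_of_nonneg_right ((M.P s a).sqrt_var_le_add e2) hq
    have e5 := two_mul_sqrt_mul_le ((M.P s a).var_nonneg (M.V π')) hh hq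
    have e6 := abs_le.1 (e3 (M'.P s a))
    have e7 := abs_le.1 (e3 (M.P s a))
    have e8 := abs_le.1 hW2
    exact abs_le.2 ⟨by linarith, by linarith⟩
  have hD0 : 0 ≤ D := abs_nonneg _
  -- `D` reappears on the right through the variance comparison, with coefficient at most 2qh² ≤
  -- 1/9, and is absorbed on the left.
  have hD' : D ≤ M.γ * (9 * Y) + 3 * h ^ 2 * ε := by
    have e1 : h ^ 2 * (2 * q * (2 * q + ε + D)) ≤ 1 / 9 * (2 * Y + ε + D) := by
      have := mul_le_mul_of_nonneg_right hqh (show 0 ≤ 2 * (2 * q + ε + D) by positivity)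
      linarith
    have e2 : 5 / 4 * q * h ^ 3 + h ^ 2 * (q * h +
      (2 * q * (2 * q + ε + D) + h ^ 2 * q ^ 2 + 2 * (2 * q + ε))) ≤
      7 * Y + 1 / 9 * (ε + D) + 2 * (h ^ 2 * ε) := by
      linarith
    have e3 := hT2.trans (mul_le_mul_of_nonneg_left e2 hγ0)
    have e4 : ε ≤ h ^ 2 * ε := le_mul_of_one_le_left hε0 hh21
    have e5 : M.γ * (1 / 9 * (ε + D) + 2 * (h ^ 2 * ε)) ≤
        1 * (1 / 9 * (ε + D) + 2 * (h ^ 2 * ε)) :=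
      mul_le_mul_of_nonneg_right hγ1.le (by positivity)
    have e6 : 0 ≤ M.γ * Y := by positivity
    linarith
  have h5 : M'.V π' s - M.V π' s ≤ D := (le_abs_self _).trans (ht s)
  have h6 : ε ≤ h ^ 2 * ε := le_mul_of_one_le_left hε0 hh21
  have h7 : 0 ≤ M.γ * Y := by positivity
  linarith [hε s]

end MDP

/-- A grid of `2 m + 1` points of `[0, B]`, with mesh at most `η`, covering the part of `[0, B]`
within `m η` of `c`. -/
noncomputable def gridPoint (B c η : ℝ) (m j : ℕ) : ℝ := max 0 (min B (c - m * η + j * η))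

lemma gridPoint_mem_Icc {B : ℝ} (hB : 0 ≤ B) (c η : ℝ) (m j : ℕ) :
    gridPoint B c η m j ∈ Set.Icc 0 B :=
  ⟨le_max_left _ _, max_le hB (min_le_left _ _)⟩

lemma exists_abs_sub_gridPoint_le {B c η v : ℝ} {m : ℕ} (hη : 0 < η) (hv : v ∈ Set.Icc 0 B)
    (hc : |c - v| ≤ m * η) : ∃ j : Fin (2 * m + 1), |v - gridPoint B c η m j| ≤ η := by
  have h1 := abs_le.1 hc
  set y := (v - (c - m * η)) / η with hy
  have hy0 : 0 ≤ y := div_nonneg (by linarith) hη.le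
  have hyv : v = c - m * η + y * η := by rw [hy]; field_simp; ring
  have hy2 : y ≤ 2 * m := by
    rw [hy, div_le_iff₀ hη]
    linarith
  refine ⟨⟨⌊y⌋₊, Nat.lt_succ_of_le (Nat.floor_le_of_le (by push_cast; exact hy2))⟩, ?_⟩
  have h2 := mul_le_mul_of_nonneg_right (Nat.floor_le hy0) hη.le
  have h3 := mul_le_mul_of_nonneg_right (Nat.lt_floor_add_one y).le hη.le
  simp only [gridPoint]
  set w := c - m * η + (⌊y⌋₊ : ℝ) * η
  have h4 : w ≤ v := by simp only [w]; linarith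
  have h5 : v ≤ w + η := by simp only [w]; linarith
  rw [min_eq_right (h4.trans hv.2), abs_le]
  constructor
  · linarith [max_le hv.1 h4]
  · linarith [le_max_right 0 w]

/-! ### Planning with a generative model -/

namespace MDP

variable {S A Ω : Type*} [Fintype S] [Nonempty S] [DecidableEq S] [Fintype A] [Nonempty A]
  [MeasurableSpace S] [DiscreteMeasurableSpace S]
  [MeasurableSpace A] [DiscreteMeasurableSpace A]
  [MeasurableSpace Ω] {μ : Measure Ω} [IsProbabilityMeasure μ]

/-- Planning in the empirical model built from samples of a generative model. -/
theorem exists_measurableSet_optV_sub_V_le {M : MDP S A} (hγ0 : 0 ≤ M.γ) (hγ1 : M.γ < 1)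
    (hR : ∀ s a, M.R s a ∈ Set.Icc (0 : ℝ) 1) {N : ℕ} [NeZero N] {X : S → A → Fin N → Ω → S}
    (hX : IsGenerativeSample M X μ) {δ : ℝ} (hδ0 : 0 < δ) (hδ1 : δ < 1)
    (hsize : 648 * Real.log (8 * (Fintype.card S * Fintype.card A : ℝ) / (δ * (1 - M.γ))) /
      (1 - M.γ) ^ 2 ≤ N) :
    ∃ E : Set Ω, MeasurableSet E ∧ 1 - δ < μ.real E ∧ ∀ ω ∈ E, ∀ (M' : MDP S A) (π : S → PMF A)
      (ε : ℝ), M' = ⟨fun s a => empiricalPMF fun k => X s a k ω, M.R, M.γ⟩ →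
      (∀ s, M'.optV s - M'.V π s ≤ ε) → ∀ s, M.optV s - M.V π s ≤
        20 * M.γ * √(Real.log (8 * (Fintype.card S * Fintype.card A : ℝ) / (δ * (1 - M.γ))) /
          (N * (1 - M.γ) ^ 3)) + 4 * ε / (1 - M.γ) := by
  set n : ℝ := Fintype.card S * Fintype.card A with hn
  set L := Real.log (8 * n / (δ * (1 - M.γ))) with hL
  have h1γ : 0 < 1 - M.γ := by linarith
  have hn1 : 1 ≤ n := by
    rw [hn]
    exact_mod_cast Nat.mul_pos (Fintype.card_pos (α := S)) (Fintype.card_pos (α := A))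
  have hδγ : δ * (1 - M.γ) ≤ 1 := mul_le_one₀ hδ1.le h1γ.le (by linarith)
  have hδγ0 : 0 < δ * (1 - M.γ) := by positivity
  have hL0 : 0 < L := Real.log_pos <| by
    rw [lt_div_iff₀ hδγ0]
    linarith
  have hN0 : (0 : ℝ) < N := Nat.cast_pos.2 (NeZero.pos N)
  set h := √(1 / (1 - M.γ)) with hh
  have hh0 : 0 < h := Real.sqrt_pos.2 (by positivity)
  have hh2 : h ^ 2 = 1 / (1 - M.γ) := Real.sq_sqrt (by positivity)
  have hhγ : h ^ 2 * (1 - M.γ) = 1 := by rw [hh2]; field_simp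
  have hh1 : 1 ≤ h ^ 2 := by
    rw [hh2, le_div_iff₀ h1γ]
    linarith
  have hh41 : 1 ≤ h ^ 4 := by nlinarith
  -- The factor 2 squares δ(1-γ)/(8n) in the failure probability; the resulting (1-γ)² cancels the
  -- grid size, of order h⁴.
  set q := √(2 * L / N) with hq
  have hq0 : 0 < q := Real.sqrt_pos.2 (by positivity)
  have hq2 : q ^ 2 = 2 * L / N := Real.sq_sqrt (by positivity)
  have hNq : N * q ^ 2 = 2 * L := by rw [hq2]; field_simp
  -- 648 = 2 · 18².
  have hqh : q * h ^ 2 ≤ 1 / 18 := by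
    refine abs_le_of_sq_le_sq' ?_ (by norm_num) |>.2
    rw [mul_pow, hq2, hh2]
    rw [div_le_iff₀ (by positivity)] at hsize
    rw [div_pow, one_pow, mul_one_div, div_div, div_le_iff₀ (by positivity)]
    linarith
  have hqY : q * h ^ 3 = √2 * √(L / (N * (1 - M.γ) ^ 3)) := by
    rw [← Real.sqrt_mul (by norm_num), eq_comm, Real.sqrt_eq_iff_mul_self_eq_of_pos (by positivity)]
    have : (q * h ^ 3) * (q * h ^ 3) = q ^ 2 * (h ^ 2) ^ 3 := by ring
    rw [this, hq2, hh2]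
    field_simp
  obtain ⟨π', hπ'⟩ := (isOptimalValue_optV (M := M) hγ0 hγ1).exists_V_eq hγ0 hγ1
  obtain ⟨f, hf⟩ := exists_isVarianceCertificate hγ0 hγ1 hR π'
  have hoptV := optV_mem_Icc (M := M) hγ0 hγ1 hR
  rw [← hh2] at hoptV
  -- the grid of values of the absorbing state
  set m := ⌈h ^ 4⌉₊ with hm
  have hm1 : h ^ 4 ≤ m := Nat.le_ceil _
  have hm2 : (m : ℝ) < h ^ 4 + 1 := Nat.ceil_lt_add_one (by positivity)
  have hm0 : (0 : ℝ) < m := by linarith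
  -- The radius mη = 2h⁴q is the crude bound `hcrude` on the gap between the optimal values, and the
  -- mesh is at most the accuracy 2q needed later. Hence m depends on γ alone, not on N.
  set η := 2 * h ^ 4 * q / m with hη
  have hη0 : 0 < η := by positivity
  have hηq : η ≤ 2 * q := by
    rw [hη, div_le_iff₀ hm0]
    nlinarith
  have hmη : m * η = 2 * h ^ 4 * q := by rw [hη]; field_simp
  let emp : (S → A → Fin N → S) → MDP S A := fun x => ⟨fun s a => empiricalPMF (x s a), M.R, M.γ⟩
  let u : S → ℕ → ℝ := fun s j => gridPoint (h ^ 2) (M.optV s) η m j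
  have hu : ∀ s j, u s j ∈ Set.Icc 0 (1 / (1 - M.γ)) := fun s j => by
    rw [← hh2]
    exact gridPoint_mem_Icc (by positivity) _ _ _ _
  let W : Bool ⊕ Fin (2 * m + 1) → S → (S → A → Fin N → S) → S → ℝ :=
    Sum.elim (fun b _ _ => cond b f M.optV) fun j s x => ((emp x).absorb s (u s j)).optV
  let B : Bool ⊕ Fin (2 * m + 1) → ℝ :=
    Sum.elim (fun b => cond b (5 / 4 * (h ^ 2) ^ 2) (h ^ 2)) fun _ => h ^ 2
  obtain ⟨E, hEm, hE, hEb⟩ := hX.exists_measurableSet_bernstein (W := W) (B := B) (q := q)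
    (by
      rintro (b | j) s x x' hxx'
      · rfl
      · refine congrArg (fun M' : MDP S A => M'.optV)
          (absorb_congr _ (fun y hy => ?_) rfl rfl)
        simp only [emp, hxx' y hy])
    (by
      rintro ((_ | _) | j) s x y
      · exact hoptV y
      · simpa only [W, B, Sum.elim_inl, cond_true, hh2] using hf.mem_Icc y
      · simp only [W, B, Sum.elim_inr, hh2]
        exact optV_mem_Icc (M := (emp x).absorb s (u s j)) hγ0 hγ1
          (absorb_R_mem_Icc (M := emp x) hγ1 hR (hu s j)) y)
    (by rintro ((_ | _) | j) <;> simp only [B, Sum.elim_inl, Sum.elim_inr, cond_true, cond_false] <;> positivity)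
    hq0
  refine ⟨E, hEm, lt_of_lt_of_le ?_ hE, ?_⟩
  · have e1 : Real.exp (-(N * q ^ 2)) = (δ * (1 - M.γ) / (8 * n)) ^ 2 := by
      rw [hNq, ← mul_neg, two_mul, Real.exp_add, hL, Real.exp_neg, Real.exp_log (by positivity),
        inv_div]
      ring
    have e2 : (Fintype.card (Bool ⊕ Fin (2 * m + 1)) : ℝ) = 2 * m + 3 := by
      simp only [Fintype.card_sum, Fintype.card_bool, Fintype.card_fin]
      push_cast
      ring
    rw [e1, e2, ← hn]
    -- The 2m + 1 grid functions plus the optimal value and the certificate; m < h⁴ + 1 and h⁴ ≥ 1.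
    have e3 : (2 * m + 3 : ℝ) ≤ 7 * h ^ 4 := by linarith
    have e4 : n * (2 * m + 3) * (2 * (δ * (1 - M.γ) / (8 * n)) ^ 2) ≤
        n * (7 * h ^ 4) * (2 * (δ * (1 - M.γ) / (8 * n)) ^ 2) := by gcongr
    have e5 : n * (7 * h ^ 4) * (2 * (δ * (1 - M.γ) / (8 * n)) ^ 2) =
        (h ^ 2 * (1 - M.γ)) ^ 2 * (14 / 64 * δ ^ 2 / n) := by
      field_simp
      ring
    rw [hhγ, one_pow, one_mul] at e5
    have e6 : 14 / 64 * δ ^ 2 / n < δ := by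
      rw [div_lt_iff₀ (by linarith)]
      nlinarith
    linarith
  · rintro ω hω M' π ε rfl hε s
    set x : S → A → Fin N → S := fun s a k => X s a k ω
    have hV : ∀ s a, |((emp x).P s a).expect M.optV - (M.P s a).expect M.optV| ≤
        2 * √((M.P s a).var M.optV) * q + h ^ 2 * q ^ 2 := hEb ω hω (Sum.inl false)
    have hcrude : ∀ s, |M.optV s - (emp x).optV s| ≤ m * η := fun s => by
      refine (abs_optV_sub_optV_le (M' := emp x) hγ0 hγ1 rfl rfl (β := 2 * h ^ 2 * q)
        (fun s a => (hV s a).trans ?_) s).trans ?_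
      · have e1 : √((M.P s a).var M.optV) ≤ h ^ 2 / 2 :=
          (Real.sqrt_le_left (by positivity)).2
            (((M.P s a).var_le_of_mem_Icc hoptV).trans_eq (by ring))
        have e2 := mul_le_mul_of_nonneg_right e1 hq0.le
        have e3 := mul_le_mul_of_nonneg_right hqh hq0.le
        have e4 : q ≤ q * h ^ 2 := le_mul_of_one_le_right hq0.le hh1
        linarith
      · rw [hmη, mul_div_assoc, div_eq_mul_one_div (2 * h ^ 2 * q), ← hh2]
        have : M.γ * (2 * h ^ 2 * q * h ^ 2) ≤ 1 * (2 * h ^ 2 * q * h ^ 2) := by gcongr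
        linarith
    have hmem := optV_mem_Icc (M := emp x) hγ0 hγ1 hR
    have hmem' : ∀ s, (emp x).optV s ∈ Set.Icc 0 (h ^ 2) := by rw [hh2]; exact hmem
    have hfin := optV_sub_V_le_of_bernstein (M' := emp x) hγ0 hγ1 rfl rfl hR hπ' hf hh0 hh2 hq0.le
      hqh hV (hEb ω hω (Sum.inl true)) (fun s a => by
        -- The grid index may depend on the sample, since the event `E` covers all indices at once.
        obtain ⟨j, hj⟩ := exists_abs_sub_gridPoint_le hη0 (hmem' s) (hcrude s)
        exact ⟨_, fun y => (abs_optV_sub_optV_absorb_le (M := emp x) hγ0 hγ1 s (u s j) y).trans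
          (hj.trans hηq), hEb ω hω (Sum.inr j) s a⟩) hε s
    refine hfin.trans ?_
    -- This turns 14√2 into the constant 20.
    have e1 : √2 ≤ 10 / 7 := by
      rw [Real.sqrt_le_left (by norm_num)]
      norm_num
    have e2 : q * h ^ 3 ≤ 10 / 7 * √(L / (N * (1 - M.γ) ^ 3)) := by
      rw [hqY]
      exact mul_le_mul_of_nonneg_right e1 (Real.sqrt_nonneg _)
    have e3 := mul_le_mul_of_nonneg_left e2 (show 0 ≤ 14 * M.γ by positivity)
    rw [hh2]
    have e4 : 4 * (1 / (1 - M.γ)) * ε = 4 * ε / (1 - M.γ) := by ring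
    linarith

end MDP

/-! ### Assembly: grouping error plus planning error -/

theorem theorem1 {S A G Ω : Type*}
    [Fintype S] [Nonempty S] [DecidableEq S] [MeasurableSpace S] [DiscreteMeasurableSpace S]
    [Fintype A] [MeasurableSpace A] [DiscreteMeasurableSpace A]
    [Fintype G] [MeasurableSpace G] [DiscreteMeasurableSpace G] [Nonempty G]
    [MeasurableSpace Ω] (μ : Measure Ω) [IsProbabilityMeasure μ]
    -- the MDP, with rewards in `[0, 1]`
    (M : MDP S A) (hγ0 : 0 ≤ M.γ) (hγ1 : M.γ < 1)
    (hR : ∀ s a, M.R s a ∈ Set.Icc (0 : ℝ) 1)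
    -- the grouping function and the lower-level policy
    (g : A → G) (hg : Function.Surjective g)
    (πi : G → PMF A) (hπi : ∀ h, ∀ a ∈ (πi h).support, g a = h)
    -- `N` samples of the grouped MDP for each state-group pair, `K` samples in total
    (N K : ℕ) [NeZero N] (hK : K = Fintype.card S * Fintype.card G * N)
    (X : S → G → Fin N → Ω → S) (hX : IsGenerativeSample (M.grouped πi) X μ)
    (Mhat : Ω → MDP S G)
    (hMhat : ∀ ω, Mhat ω = empiricalMDP M.γ (fun s h _ => (M.grouped πi).R s h)
      (fun s h k => X s h k ω))
    -- the output of the planner, which is `εopt`-optimal for the estimated grouped MDP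
    (πT : Ω → S → PMF G) (εopt : ℝ)
    (hπT : ∀ᵐ ω ∂μ, ‖(Mhat ω).optV - (Mhat ω).V (πT ω)‖ ≤ εopt)
    (δ : ℝ) (hδ0 : 0 < δ) (hδ1 : δ < 1)
    (hsize : 648 * (Fintype.card S * Fintype.card G : ℝ) *
        Real.log (8 * (Fintype.card S * Fintype.card G : ℝ) / (δ * (1 - M.γ)))
          / (1 - M.γ) ^ 2 ≤ K) :
    IsLeast (M.probDeviationFactors g) (M.betaP g) ∧
    IsLeast (M.rewardDeviationFactors g) (M.betaR g) ∧
    ∃ E : Set Ω, MeasurableSet E ∧ 1 - δ < μ.real E ∧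
      ∀ ω ∈ E, ‖M.optV - M.V (jointPolicy (πT ω) πi)‖ ≤
        2 * (M.γ * M.betaP g / (1 - M.γ) ^ 2 + M.betaR g / (1 - M.γ)) +
        (20 * M.γ * Real.sqrt ((Fintype.card S * Fintype.card G : ℝ) *
            Real.log (8 * (Fintype.card S * Fintype.card G : ℝ) / (δ * (1 - M.γ)))
              / (K * (1 - M.γ) ^ 3)) +
          4 * εopt / (1 - M.γ)) := by

  refine ⟨M.isLeast_betaP hg, M.isLeast_betaR hg hR, ?_⟩
  obtain ⟨a₀, -⟩ := hg (Classical.arbitrary G)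
  have hA : Nonempty A := ⟨a₀⟩
  have h1γ : 0 < 1 - M.γ := by linarith
  set n : ℝ := Fintype.card S * Fintype.card G with hn
  have hn0 : 0 < n := by
    rw [hn]
    exact_mod_cast Nat.mul_pos (Fintype.card_pos (α := S)) (Fintype.card_pos (α := G))
  have hKn : (K : ℝ) = n * N := by
    rw [hK, hn]
    push_cast
    ring
  have hN0 : (0 : ℝ) < N := Nat.cast_pos.2 (NeZero.pos N)
  have hRG : ∀ s h, (M.grouped πi).R s h ∈ Set.Icc (0 : ℝ) 1 := fun s h =>
    ⟨(πi h).le_expect fun a => (hR s a).1, (πi h).expect_le fun a => (hR s a).2⟩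
  obtain ⟨E, hEm, hE, hEb⟩ := MDP.exists_measurableSet_optV_sub_V_le (M := M.grouped πi) hγ0 hγ1
    hRG hX hδ0 hδ1 (by
      refine le_of_mul_le_mul_left ?_ hn0
      rw [← hKn]
      refine le_trans (le_of_eq ?_) hsize
      simp only [MDP.grouped, ← hn]
      ring)
  -- The outcomes where the planner fails form a null set, not assumed measurable; a measurable null
  -- superset is removed from `E`.
  obtain ⟨F, hFs, hFm, hF⟩ := exists_measurable_superset_of_null (ae_iff.1 hπT)
  refine ⟨E \ F, hEm.diff hFm, ?_, fun ω hω => ?_⟩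
  · rwa [measureReal_def, measure_sdiff_null hF]
  · have hplan : ‖(Mhat ω).optV - (Mhat ω).V (πT ω)‖ ≤ εopt := by
      by_contra hcon
      exact hω.2 (hFs hcon)
    have hmodel : Mhat ω = ⟨fun s h => empiricalPMF fun k => X s h k ω, (M.grouped πi).R,
        (M.grouped πi).γ⟩ := by
      rw [hMhat, empiricalMDP, MDP.mk.injEq]
      refine ⟨rfl, funext fun s => funext fun h => ?_, rfl⟩
      simp only [Finset.sum_const, Finset.card_univ, Fintype.card_fin, nsmul_eq_mul]
      field_simp
    have hbound := hEb ω hω.1 (Mhat ω) (πT ω) εopt hmodel fun s =>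
      (le_abs_self _).trans ((norm_le_pi_norm ((Mhat ω).optV - (Mhat ω).V (πT ω)) s).trans hplan)
    have hP0 : 0 ≤ M.betaP g := (M.isLeast_betaP hg).1.elim fun b hb => by
      obtain ⟨P₁, P₂, hb, -, h⟩ := hb
      rw [h]
      exact Real.iSup_nonneg fun z => (hb z.1 z.2).1
    have hR0 : 0 ≤ M.betaR g := by
      have := M.sub_le_betaR g (Classical.arbitrary S) (rfl : g a₀ = g a₀)
      rwa [sub_self] at this
    refine (pi_norm_le_iff_of_nonempty _).2 fun s => ?_
    rw [Pi.sub_apply, Real.norm_eq_abs, abs_of_nonneg (sub_nonneg.2 (MDP.V_le_optV hγ0 hγ1 _ s)),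
      MDP.V_jointPolicy M hγ0 hγ1]
    have h1 := M.optV_sub_optV_grouped_le hπi hγ0 hγ1 hR s
    have h2 := hbound s
    -- The grouping error enters only once, so nonnegativity of the bracket accounts for the factor
    -- 2.
    have h3 : 0 ≤ M.γ * M.betaP g / (1 - M.γ) ^ 2 + M.betaR g / (1 - M.γ) := by positivity
    have h4 : n * Real.log (8 * n / (δ * (1 - M.γ))) / (K * (1 - M.γ) ^ 3) =
        Real.log (8 * n / (δ * (1 - M.γ))) / (N * (1 - M.γ) ^ 3) := by
      rw [hKn]
      field_simp
    rw [h4]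
    have h5 : (M.grouped πi).γ = M.γ := rfl
    rw [h5, ← hn] at h2
    linarith
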